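/- Let $(R,\mathfrak m)$ be a Cohen–Macaulay (Noetherian) local ring of dimension $d>0$ with infinite residue field $R/\mathfrak m$, and let $I$ be an $\mathfrak m$-primary ideal of $R$. A reduction of $I$ is an ideal $J\subseteq I$ with $I^{n+1}=JI^n$ for some $n\ge 0$; a minimal reduction of $I$ is a reduction of $I$ that is minimal with respect to inclusion among the reductions of $I$. Write $\lambda$ for the length of an $R$-module, and let $J$ be a minimal reduction of $I$. Then the following lengths are finite and independent of $J$, i.e. they take the same value for any two minimal reductions of $I$: (a) $\lambda(I/J)$, and $\lambda(I^n/J^{n-1}I)$ for every $n\geq 2$; (b) $\lambda(R/(J\colon I))$, where $J\colon I=\{r\in R : rI\subseteq J\}$; (c) $\lambda(S_2(I/J))$, where $S_2(I/J)$ denotes the degree-two component of the symmetric algebra over $R$ of the $R$-module $I/J$. -/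

import Mathlib

/-- The depth of a local ring: the supremum of the lengths of the regular sequences contained
in the maximal ideal. -/
noncomputable def localDepth (R : Type*) [CommRing R] [IsLocalRing R] : ℕ∞ :=
  sSup {k : ℕ∞ | ∃ rs : List R, RingTheory.Sequence.IsRegular R rs ∧
    (∀ r ∈ rs, r ∈ IsLocalRing.maximalIdeal R) ∧ k = (rs.length : ℕ∞)}

/-- A Cohen–Macaulay local ring: a Noetherian local ring whose depth equals its dimension. -/
structure IsCohenMacaulayLocal (R : Type*) [CommRing R] [IsLocalRing R] : Prop where
  noetherian : IsNoetherianRing R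
  depth_eq_dim : (localDepth R : WithBot ℕ∞) = ringKrullDim R

/-- `J` is a reduction of `I`: `J ⊆ I` and `I ^ (n + 1) = J I ^ n` for some `n ≥ 0`. -/
def IsReductionOf {R : Type*} [CommRing R] (J I : Ideal R) : Prop :=
  J ≤ I ∧ ∃ n : ℕ, I ^ (n + 1) = J * I ^ n

/-- `J` is a minimal reduction of `I`: minimal, under inclusion, among the reductions of `I`. -/
def IsMinimalReductionOf {R : Type*} [CommRing R] (J I : Ideal R) : Prop :=
  Minimal (fun K : Ideal R => IsReductionOf K I) J

/-- The `R`-module `A / B`, for ideals `B ⊆ A` of `R`. -/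
abbrev IdealQuot {R : Type*} [CommRing R] (A B : Ideal R) : Type _ :=
  ↥A ⧸ Submodule.submoduleOf B A

/-- The degree `k` component of the symmetric algebra of `M`: the `R`-submodule spanned by the
`k`-fold products of elements of `M`. -/
noncomputable def symComponent (R : Type*) [CommRing R] (k : ℕ) (M : Type*) [AddCommGroup M]
    [Module R M] : Submodule R (SymmetricAlgebra R M) :=
  LinearMap.range (SymmetricAlgebra.ι R M) ^ k

/-! Put d = dim R. As the residue field is infinite, a minimal reduction J of I is generated by d
elements. These generate an ideal primary to m, so they form a regular sequence in every order
because R is Cohen–Macaulay (`IsMinimalReductionOf.exists_ofList`). The bound on the number of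
generators comes from growth: if s is the least number of generators of a reduction of J, the
monomials in such generators are independent in the fiber cone of J, so s cannot exceed d, the
degree of growth of λ(R/J^n).

For J generated by a regular sequence, J^n/J^(n+1) and J^n/J^n I are free over R/J and R/I, with
ranks counting monomials. Hence λ(R/J^(n+1) I) depends only on n, d, λ(R/J) and λ(R/I)
(`length_quotient_sup_pow_mul`). Powers of two reductions of I contain each other up to a bounded
shift, so comparing leading coefficients shows that λ(R/J) is the same for both
(`length_quotient_ofList_le`). Subtracting the lengths of R/I and R/I^n gives (a).

For (b), (J : I)/J = Hom(R/I, R/J) is Ext^d(R/I, R), which does not see J. The equality of lengths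
is proved directly, by exchanging elements of regular sequences (`length_colon_sup_ofList_eq`), and
subtracted from λ(R/J).

For (c), the sequence 0 → ker(Sym² I → I²) → S_2(I/J) → I²/JI → 0 is exact
(`length_symComponent_two`). Its left term depends on I alone, and its right term is the case n = 2
of (a). -/

open RingTheory.Sequence IsLocalRing

/-! ### Regular sequences modulo an ideal and modulo powers -/

section RegularSequences

variable {R : Type*} [CommRing R]

/-- Multiplication by `z` is injective on `R ⧸ A`. -/
def IsRegularMod (A : Ideal R) (z : R) : Prop := ∀ u, u * z ∈ A → u ∈ A

/-- The list is a weakly regular sequence on `R ⧸ A`. -/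
def IsRegularSeqMod : Ideal R → List R → Prop
  | _, [] => True
  | A, z :: l => IsRegularMod A z ∧ IsRegularSeqMod (A ⊔ Ideal.span {z}) l

theorem isRegularSeqMod_append (A : Ideal R) (x y : List R) :
    IsRegularSeqMod A (x ++ y) ↔
      IsRegularSeqMod A x ∧ IsRegularSeqMod (A ⊔ Ideal.ofList x) y := by
  induction x generalizing A with
  | nil => simp [IsRegularSeqMod]
  | cons z x ih => simp [IsRegularSeqMod, ih, and_assoc, sup_assoc]

theorem mem_sup_span_singleton {A : Ideal R} {z u : R} :
    u ∈ A ⊔ Ideal.span {z} ↔ ∃ a ∈ A, ∃ t, u = a + t * z := by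
  simp only [Submodule.mem_sup, Ideal.mem_span_singleton']
  constructor
  · rintro ⟨a, ha, _, ⟨t, rfl⟩, rfl⟩
    exact ⟨a, ha, t, rfl⟩
  · rintro ⟨a, ha, t, rfl⟩
    exact ⟨a, ha, _, ⟨t, rfl⟩, rfl⟩

theorem isRegularSeqMod_top (l : List R) : IsRegularSeqMod (⊤ : Ideal R) l := by
  induction l with
  | nil => trivial
  | cons z l ih => exact ⟨fun _ _ => trivial, by rwa [top_sup_eq]⟩

/-- In 0 → R/(B : z) → R/B → R/(B + z) → 0, an element y regular on both ends is regular in the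
middle. Reduction modulo y keeps the sequence of this form, since (B + y) : z = (B : z) + y when y
is regular on R/(B + z). -/
theorem isRegularSeqMod_of_colon {B : Ideal R} {z : R} {l : List R}
    (h₁ : IsRegularSeqMod (B.colon {z}) l) (h₂ : IsRegularSeqMod (B ⊔ Ideal.span {z}) l) :
    IsRegularSeqMod B l := by
  induction l generalizing B with
  | nil => trivial
  | cons y l ih =>
    obtain ⟨hy₁, hl₁⟩ := h₁
    obtain ⟨hy₂, hl₂⟩ := h₂
    refine ⟨fun u hu => ?_, ih ?_ ?_⟩
    · obtain ⟨b, hb, t, rfl⟩ := mem_sup_span_singleton.1 (hy₂ u (Submodule.mem_sup_left hu))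
      have : t ∈ B.colon {z} := hy₁ t <| by
        rw [Submodule.mem_colon_singleton, smul_eq_mul]
        have := B.sub_mem hu (B.mul_mem_right y hb)
        convert this using 1; ring
      rw [Submodule.mem_colon_singleton, smul_eq_mul] at this
      exact B.add_mem hb this
    · convert hl₁ using 1
      ext u
      simp only [Submodule.mem_colon_singleton, smul_eq_mul, mem_sup_span_singleton]
      constructor
      · rintro ⟨b, hb, t, h⟩
        have h1 : t * y ∈ B ⊔ Ideal.span {z} :=
          mem_sup_span_singleton.2 ⟨-b, B.neg_mem hb, u, by linear_combination -h⟩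
        obtain ⟨b', hb', s, hs⟩ := mem_sup_span_singleton.1 (hy₂ t h1)
        refine ⟨u - s * y, ?_, s, by ring⟩
        have : (u - s * y) * z = b + b' * y := by
          linear_combination h + y * hs
        rw [this]
        exact B.add_mem hb (B.mul_mem_right _ hb')
      · rintro ⟨a, ha, t, rfl⟩
        exact ⟨a * z, ha, t * z, by ring⟩
    · rwa [sup_right_comm]

theorem colon_singleton_eq_of_isRegularMod {A B C : Ideal R} {z : R} (hA : IsRegularMod A z)
    (hAC : A ≤ C) (hB : B ≤ A ⊔ Ideal.span {z} * C) (hCB : Ideal.span {z} * C ≤ B) :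
    B.colon {z} = C := by
  ext u
  rw [Submodule.mem_colon_singleton, smul_eq_mul]
  constructor
  · intro h
    obtain ⟨a, ha, b, hb, hab⟩ := Submodule.mem_sup.1 (hB h)
    obtain ⟨c, hc, rfl⟩ := Ideal.mem_span_singleton_mul.1 hb
    have : u - c ∈ A := hA _ (by
      have : (u - c) * z = a := by linear_combination -hab
      rwa [this])
    simpa using C.add_mem (hAC this) hc
  · intro h
    rw [mul_comm u z]
    exact hCB <| Ideal.mul_mem_mul (Ideal.mem_span_singleton_self z) h

theorem sup_pow_succ_eq (Q Z : Ideal R) (n : ℕ) :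
    (Q ⊔ Z) ^ (n + 1) = Q ^ (n + 1) ⊔ Z * (Q ⊔ Z) ^ n := by
  refine le_antisymm ?_ (sup_le (Ideal.pow_right_mono le_sup_left _) ?_)
  · induction n with
    | zero => simp
    | succ n ih =>
      calc (Q ⊔ Z) ^ (n + 1 + 1) = Q * (Q ⊔ Z) ^ (n + 1) ⊔ Z * (Q ⊔ Z) ^ (n + 1) := by
            rw [pow_succ' _ (n + 1), Ideal.sup_mul]
        _ ≤ Q ^ (n + 1 + 1) ⊔ Z * (Q ⊔ Z) ^ (n + 1) := by
            refine sup_le ((Ideal.mul_mono_right ih).trans ?_) le_sup_right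
            rw [Ideal.mul_sup, ← pow_succ', mul_left_comm, pow_succ' (Q ⊔ Z) n]
            exact sup_le_sup_left (Ideal.mul_mono_right (Ideal.mul_mono_left le_sup_left)) _
  · rw [pow_succ']
    exact Ideal.mul_mono_left le_sup_right

/-- Peel off the last element z of x, and let Q be generated by the others. For B = A + (Q +
z)^(n+1), the colon B : z is the same ideal with exponent n, while B + z = A + Q^(n+1) + z falls
under the induction on x. -/
theorem IsRegularSeqMod.sup_pow {A : Ideal R} {x y : List R} (h : IsRegularSeqMod A (x ++ y))
    (n : ℕ) : IsRegularSeqMod (A ⊔ Ideal.ofList x ^ n) y := by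
  induction x using List.reverseRecOn generalizing y n with
  | nil =>
    rcases n with _ | n
    · simpa using isRegularSeqMod_top y
    · rwa [Ideal.ofList_nil, ← Ideal.zero_eq_bot, zero_pow n.succ_ne_zero, Ideal.zero_eq_bot,
        sup_bot_eq]
  | append_singleton x z ih =>
    rw [List.append_assoc, List.singleton_append] at h
    have key : ∀ n, IsRegularMod (A ⊔ Ideal.ofList x ^ n) z ∧
      IsRegularSeqMod (A ⊔ Ideal.ofList x ^ n ⊔ Ideal.span {z}) y := fun n => ih h n
    have hs : Ideal.ofList (x ++ [z]) = Ideal.ofList x ⊔ Ideal.span {z} := by simp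
    rw [hs]
    generalize Ideal.ofList x = Q at key
    generalize hZ : Ideal.span {z} = Z at key
    induction n with
    | zero => simpa using isRegularSeqMod_top y
    | succ n ihn =>
      refine isRegularSeqMod_of_colon (z := z) ?_ ?_
      · rw [colon_singleton_eq_of_isRegularMod (key (n + 1)).1 (C := A ⊔ (Q ⊔ Z) ^ n)]
        · exact ihn
        · exact sup_le_sup_left ((Ideal.pow_right_mono le_sup_left _).trans
            (Ideal.pow_le_pow_right n.le_succ)) _
        · rw [hZ, sup_pow_succ_eq, ← sup_assoc]
          exact sup_le_sup_left (Ideal.mul_mono_right le_sup_right) _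
        · rw [hZ, sup_pow_succ_eq, Ideal.mul_sup]
          exact sup_le (Ideal.mul_le_right.trans le_sup_left) (le_sup_right.trans le_sup_right)
      · rw [hZ, sup_pow_succ_eq, ← sup_assoc, sup_assoc (A ⊔ Q ^ (n + 1)),
          sup_eq_right.2 (Ideal.mul_le_left : Z * (Q ⊔ Z) ^ n ≤ _)]
        exact (key (n + 1)).2

/-- Quotients of `R` have additive length along the exact sequence
`0 → R ⧸ (B : z) → R ⧸ B → R ⧸ (B + z) → 0`. -/
theorem length_quotient_colon_singleton (B : Ideal R) (z : R) :
    Module.length R (R ⧸ B) =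
      Module.length R (R ⧸ B.colon {z}) + Module.length R (R ⧸ (B ⊔ Ideal.span {z})) := by
  let f : (R ⧸ B.colon {z}) →ₗ[R] R ⧸ B :=
    Submodule.mapQ (B.colon {z}) B (LinearMap.mulRight R z) fun u hu => by
      simpa [Submodule.mem_colon_singleton] using hu
  refine Module.length_eq_add_of_exact f (Submodule.factor le_sup_left) ?_
    (Submodule.factor_surjective _) ?_
  · rw [← LinearMap.ker_eq_bot, LinearMap.ker_eq_bot']
    intro u hu
    obtain ⟨u, rfl⟩ := Submodule.Quotient.mk_surjective _ u
    simp only [f, Submodule.mapQ_apply, Submodule.Quotient.mk_eq_zero] at hu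
    rw [Submodule.Quotient.mk_eq_zero, Submodule.mem_colon_singleton]
    simpa using hu
  · intro u
    obtain ⟨u, rfl⟩ := Submodule.Quotient.mk_surjective _ u
    change Submodule.Quotient.mk u = 0 ↔ _
    rw [Submodule.Quotient.mk_eq_zero, mem_sup_span_singleton]
    constructor
    · rintro ⟨a, ha, t, rfl⟩
      refine ⟨Submodule.Quotient.mk t, ?_⟩
      simp only [f, Submodule.mapQ_apply]
      rw [Submodule.Quotient.eq]
      simpa using ha
    · rintro ⟨t, ht⟩
      obtain ⟨t, rfl⟩ := Submodule.Quotient.mk_surjective _ t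
      simp only [f, Submodule.mapQ_apply] at ht
      rw [eq_comm, Submodule.Quotient.eq] at ht
      exact ⟨_, ht, t, by simp⟩

theorem length_quotient_eq_add_idealQuot {A B : Ideal R} (h : A ≤ B) :
    Module.length R (R ⧸ A) =
      Module.length R (IdealQuot B A) + Module.length R (R ⧸ B) := by
  let f : IdealQuot B A →ₗ[R] R ⧸ A :=
    Submodule.mapQ (Submodule.submoduleOf A B) A B.subtype le_rfl
  refine Module.length_eq_add_of_exact f (Submodule.factor h) ?_
    (Submodule.factor_surjective _) ?_
  · rw [← LinearMap.ker_eq_bot, LinearMap.ker_eq_bot']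
    intro u hu
    obtain ⟨u, rfl⟩ := Submodule.Quotient.mk_surjective _ u
    have hu' : (Submodule.Quotient.mk (u : R) : R ⧸ A) = 0 := hu
    rw [Submodule.Quotient.mk_eq_zero] at hu' ⊢
    exact hu'
  · intro u
    obtain ⟨u, rfl⟩ := Submodule.Quotient.mk_surjective _ u
    change Submodule.Quotient.mk u = 0 ↔ _
    rw [Submodule.Quotient.mk_eq_zero]
    constructor
    · intro hu
      exact ⟨Submodule.Quotient.mk ⟨u, hu⟩, rfl⟩
    · rintro ⟨t, ht⟩
      obtain ⟨t, rfl⟩ := Submodule.Quotient.mk_surjective _ t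
      replace ht : (Submodule.Quotient.mk (t : R) : R ⧸ A) = Submodule.Quotient.mk u := ht
      rw [eq_comm, Submodule.Quotient.eq] at ht
      simpa using B.add_mem (h ht) t.2

end RegularSequences

/-! ### Colengths of powers of an ideal generated by a regular sequence -/

section LengthOfPowers

variable {R : Type*} [CommRing R]

/-- The coefficients count the monomials in the generators of degree at most n and of degree exactly
n + 1. Colon and sum with the head z reproduce Pascal's rule for them. All orders of `l` are needed:
z last gives regularity modulo A + Q^n, z first gives the induction modulo A + z. -/
theorem length_quotient_sup_pow_mul {A I : Ideal R} {l : List R}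
    (hl : ∀ l', l'.Perm l → IsRegularSeqMod A l') (hI : A ⊔ Ideal.ofList l ≤ I) (n : ℕ) :
    Module.length R (R ⧸ (A ⊔ Ideal.ofList l ^ (n + 1) * I)) =
      Nat.multichoose (l.length + 1) n * Module.length R (R ⧸ (A ⊔ Ideal.ofList l)) +
      Nat.multichoose l.length (n + 1) * Module.length R (R ⧸ I) := by
  induction l generalizing A n with
  | nil =>
    rw [Ideal.ofList_nil, ← Ideal.zero_eq_bot, zero_pow n.succ_ne_zero, zero_mul,
      Ideal.zero_eq_bot, sup_bot_eq]
    simp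
  | cons z l ih =>
    rw [Ideal.ofList_cons] at hI
    have hreg : ∀ n, IsRegularMod (A ⊔ Ideal.ofList l ^ n) z := fun n =>
      ((hl (l ++ [z]) (List.perm_append_singleton z l)).sup_pow n).1
    have ih' := ih (A := A ⊔ Ideal.span {z}) (fun l' h => (hl (z :: l') (h.cons z)).2)
      (by rwa [sup_assoc])
    have hstep : ∀ n, Module.length R (R ⧸ (A ⊔ Ideal.ofList (z :: l) ^ (n + 1) * I)) =
        Module.length R (R ⧸ (A ⊔ Ideal.ofList (z :: l) ^ n * I)) +
        Module.length R (R ⧸ (A ⊔ Ideal.span {z} ⊔ Ideal.ofList l ^ (n + 1) * I)) := by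
      intro n
      rw [length_quotient_colon_singleton _ z]
      rw [Ideal.ofList_cons, sup_comm (Ideal.span {z})]
      have hr := hreg (n + 1)
      generalize Ideal.ofList l = Q at *
      have hcolon : (A ⊔ (Q ⊔ Ideal.span {z}) ^ (n + 1) * I).colon {z} =
          A ⊔ (Q ⊔ Ideal.span {z}) ^ n * I := by
        rw [colon_singleton_eq_of_isRegularMod hr]
        · refine sup_le_sup_left ?_ _
          rw [pow_succ]
          exact Ideal.mul_mono (Ideal.pow_right_mono le_sup_left _)
            ((le_sup_right.trans le_sup_right).trans hI)
        · rw [sup_pow_succ_eq, Ideal.sup_mul, ← sup_assoc, mul_assoc]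
          exact sup_le_sup (sup_le_sup_left Ideal.mul_le_left _)
            (Ideal.mul_mono_right le_sup_right)
        · rw [sup_pow_succ_eq, Ideal.mul_sup, Ideal.sup_mul, mul_assoc]
          exact sup_le (Ideal.mul_le_right.trans le_sup_left) (le_sup_right.trans le_sup_right)
      have hsup : A ⊔ (Q ⊔ Ideal.span {z}) ^ (n + 1) * I ⊔ Ideal.span {z} =
          A ⊔ Ideal.span {z} ⊔ Q ^ (n + 1) * I := by
        rw [sup_pow_succ_eq, Ideal.sup_mul, ← sup_assoc, mul_assoc, sup_assoc (A ⊔ _),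
          sup_eq_right.2 (Ideal.mul_le_left : Ideal.span {z} * _ ≤ _), sup_right_comm]
      rw [hcolon, hsup]
    induction n with
    | zero =>
      have h0 : A ⊔ Ideal.ofList (z :: l) ^ 0 * I = I := by
        rw [pow_zero, one_mul, sup_eq_right.2 (le_sup_left.trans hI)]
      rw [hstep, h0, ih', sup_assoc, ← Ideal.ofList_cons]
      simp only [List.length_cons,
        Nat.multichoose_zero_right, zero_add, Nat.multichoose_one_right, Nat.cast_one, one_mul,
        Nat.cast_add, add_mul]
      ring
    | succ n ihn =>
      rw [hstep, ihn, ih', sup_assoc, ← Ideal.ofList_cons, List.length_cons,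
        Nat.multichoose_succ_succ (l.length + 1) n, Nat.multichoose_succ_succ l.length (n + 1)]
      push_cast
      ring

theorem length_quotient_sup_pow {A : Ideal R} {l : List R}
    (hl : ∀ l', l'.Perm l → IsRegularSeqMod A l') (n : ℕ) :
    Module.length R (R ⧸ (A ⊔ Ideal.ofList l ^ (n + 1))) =
      Nat.multichoose (l.length + 1) n * Module.length R (R ⧸ (A ⊔ Ideal.ofList l)) := by
  have := length_quotient_sup_pow_mul (I := ⊤) hl le_top n
  rwa [Ideal.mul_top, Module.length_eq_zero (M := R ⧸ (⊤ : Ideal R)), mul_zero, add_zero] at this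

end LengthOfPowers

/-! ### Comparison of polynomial growth -/

section Growth

theorem multichoose_succ_eq_choose (k n : ℕ) : Nat.multichoose (k + 1) n = (n + k).choose k := by
  rw [Nat.multichoose_eq, show k + 1 + n - 1 = n + k by omega]
  exact Nat.choose_symm_of_eq_add rfl

theorem multichoose_succ_le (k n : ℕ) : Nat.multichoose (k + 1) n ≤ (n + k) ^ k := by
  rw [multichoose_succ_eq_choose]
  exact Nat.choose_le_pow _ _

/-- `Nat.multichoose (k + 1) n` is a polynomial of degree k in n, and the shift by r leaves its
leading coefficient unchanged. -/
theorem le_of_forall_mul_multichoose_le {k r a b : ℕ}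
    (h : ∀ n, a * Nat.multichoose (k + 1) n ≤ b * Nat.multichoose (k + 1) (n + r)) : a ≤ b := by
  have h₁ : ∀ n, a * (n + 1) ^ k ≤ b * (n + r + k) ^ k := by
    intro n
    have h₂ := h n
    rw [multichoose_succ_eq_choose, multichoose_succ_eq_choose] at h₂
    calc a * (n + 1) ^ k ≤ a * (n + k).descFactorial k := by
          gcongr
          have := Nat.pow_sub_le_descFactorial (n + k) k
          rwa [show n + k + 1 - k = n + 1 by omega] at this
      _ = k.factorial * (a * (n + k).choose k) := by
          rw [Nat.descFactorial_eq_factorial_mul_choose]; ring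
      _ ≤ k.factorial * (b * (n + r + k).choose k) := Nat.mul_le_mul_left _ h₂
      _ = b * (n + r + k).descFactorial k := by
          rw [Nat.descFactorial_eq_factorial_mul_choose]; ring
      _ ≤ b * (n + r + k) ^ k := Nat.mul_le_mul_left _ (Nat.descFactorial_le_pow _ _)
  have hlim : Filter.Tendsto
      (fun n : ℕ => (b : ℝ) * (1 + ((r : ℝ) + k - 1) * (1 / ((n : ℝ) + 1))) ^ k)
      Filter.atTop (nhds ((b : ℝ) * (1 + ((r : ℝ) + k - 1) * 0) ^ k)) :=
    ((tendsto_one_div_add_atTop_nhds_zero_nat.const_mul _).const_add _ |>.pow k).const_mul _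
  have := ge_of_tendsto' hlim (b := (a : ℝ)) fun n => by
    have h₂ : (a : ℝ) * ((n : ℝ) + 1) ^ k ≤ b * ((n : ℝ) + r + k) ^ k := by exact_mod_cast h₁ n
    have hn : (0 : ℝ) < (n : ℝ) + 1 := by positivity
    have h₃ : 1 + ((r : ℝ) + k - 1) * (1 / ((n : ℝ) + 1)) = ((n : ℝ) + r + k) / (n + 1) := by
      field_simp; ring
    rw [h₃, div_pow, ← mul_div_assoc, le_div_iff₀ (by positivity)]
    exact h₂
  simpa using this

theorem le_of_forall_pow_le_mul_pow {s d a b c : ℕ}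
    (h : ∀ n, (n + 1) ^ s ≤ c * (a * n + b) ^ d) : s ≤ d := by
  by_contra! hsd
  obtain ⟨t, rfl⟩ := Nat.exists_eq_add_of_lt hsd
  have h₁ : ∀ n, n + 1 ≤ c * (a + b) ^ d := fun n => by
    have h₂ : (n + 1) * (n + 1) ^ d ≤ c * (a + b) ^ d * (n + 1) ^ d := calc
      (n + 1) * (n + 1) ^ d = (n + 1) ^ (d + 1) := by ring
      _ ≤ (n + 1) ^ (d + t + 1) := Nat.pow_le_pow_right n.succ_pos (by omega)
      _ ≤ c * (a * n + b) ^ d := h n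
      _ ≤ c * ((a + b) * (n + 1)) ^ d := by gcongr; nlinarith
      _ = _ := by rw [mul_pow]; ring
    exact Nat.le_of_mul_le_mul_right h₂ (by positivity)
  have := h₁ (c * (a + b) ^ d)
  omega

end Growth

/-! ### Exchange of elements in regular sequences -/

section Exchange

variable {R : Type*} [CommRing R]

theorem subsingleton_idealQuot_iff {A B : Ideal R} : Subsingleton (IdealQuot B A) ↔ B ≤ A := by
  rw [Submodule.Quotient.subsingleton_iff, Submodule.submoduleOf_eq_top]

theorem colon_le_of_isRegularMod {A I : Ideal R} {z : R} (hz : z ∈ I) (h : IsRegularMod A z) :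
    A.colon (I : Set R) ≤ A := fun u hu => h u (Submodule.mem_colon.1 hu z hz)

/-- C : I ⊆ C forces I to lie in no associated prime of R/C. Prime avoidance over the finitely many
associated primes of both quotients yields one z for both. -/
theorem exists_isRegularMod_mem [IsNoetherianRing R] {A B I : Ideal R}
    (hA : A.colon (I : Set R) ≤ A) (hB : B.colon (I : Set R) ≤ B) :
    ∃ z ∈ I, IsRegularMod A z ∧ IsRegularMod B z := by
  have key : ∀ {C : Ideal R} {z : R}, z ∉ ⋃ p ∈ associatedPrimes R (R ⧸ C), (p : Set R) →
      IsRegularMod C z := by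
    intro C z hz u hu
    rw [biUnion_associatedPrimes_eq_zero_divisors] at hz
    by_contra hC
    refine hz ⟨Submodule.Quotient.mk u, ?_, ?_⟩
    · rwa [ne_eq, Submodule.Quotient.mk_eq_zero]
    · rw [← Submodule.Quotient.mk_smul, Submodule.Quotient.mk_eq_zero, smul_eq_mul, mul_comm]
      exact hu
  have key₂ : ∀ {C P : Ideal R}, C.colon (I : Set R) ≤ C → P ∈ associatedPrimes R (R ⧸ C) →
      ¬ I ≤ P := by
    intro C P hC hP hIP
    obtain ⟨hprime, x, hx⟩ := isAssociatedPrime_iff.1 hP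
    obtain ⟨x, rfl⟩ := Submodule.Quotient.mk_surjective _ x
    refine hprime.ne_top (hx.trans ?_)
    have : x ∈ C := hC <| Submodule.mem_colon.2 fun i hi => by
      have := hIP hi
      rw [hx, Submodule.mem_colon_singleton, ← Submodule.Quotient.mk_smul, Submodule.mem_bot,
        Submodule.Quotient.mk_eq_zero] at this
      rwa [smul_eq_mul, mul_comm]
    rw [(Submodule.Quotient.mk_eq_zero C).2 this]
    simp
  have hfin := (associatedPrimes.finite R (R ⧸ A)).union (associatedPrimes.finite R (R ⧸ B))
  have hav := (Ideal.subset_union_prime_finite (f := fun p : Ideal R => p) hfin ⊥ ⊥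
    (fun P hP _ _ => hP.elim (fun h => h.isPrime) (fun h => h.isPrime)) (I := I)).not.2 (by
      rintro ⟨P, hP | hP, hle⟩
      exacts [key₂ hA hP hle, key₂ hB hP hle])
  obtain ⟨z, hz, hz'⟩ := Set.not_subset.1 hav
  rw [Set.biUnion_union, Set.mem_union, not_or] at hz'
  exact ⟨z, hz, key hz'.1, key hz'.2⟩

/-- The isomorphism is multiplication by y. Regularity of y makes it injective; for w in the target
colon, x ∈ I gives wx = a + txy, so w − ty ∈ A by regularity of x. As xy is symmetric, x can then be
traded for y. -/
theorem length_colon_sup_span_mul {A I : Ideal R} {x y : R} (hx : x ∈ I)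
    (hrx : IsRegularMod A x) (hry : IsRegularMod A y) :
    Module.length R (IdealQuot ((A ⊔ Ideal.span {x}).colon (I : Set R)) (A ⊔ Ideal.span {x})) =
    Module.length R
      (IdealQuot ((A ⊔ Ideal.span {x * y}).colon (I : Set R)) (A ⊔ Ideal.span {x * y})) := by
  have hmem : ∀ r, r * y ∈ A ⊔ Ideal.span {x * y} ↔ r ∈ A ⊔ Ideal.span {x} := by
    intro r
    rw [mem_sup_span_singleton, mem_sup_span_singleton]
    constructor
    · rintro ⟨a, ha, t, h⟩
      refine ⟨r - t * x, hry _ ?_, t, by ring⟩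
      rwa [show (r - t * x) * y = a by linear_combination h]
    · rintro ⟨a, ha, t, rfl⟩
      exact ⟨a * y, A.mul_mem_right _ ha, t, by ring⟩
  have hcol : ∀ r, r * y ∈ (A ⊔ Ideal.span {x * y}).colon (I : Set R) ↔
      r ∈ (A ⊔ Ideal.span {x}).colon (I : Set R) := by
    intro r
    simp only [Submodule.mem_colon, smul_eq_mul]
    refine forall₂_congr fun i _ => ?_
    rw [← hmem, mul_right_comm]
  let g : ↥((A ⊔ Ideal.span {x}).colon (I : Set R)) →ₗ[R]
      ↥((A ⊔ Ideal.span {x * y}).colon (I : Set R)) :=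
    (LinearMap.mulRight R y).restrict fun r hr => (hcol r).2 hr
  have hg : ∀ r, ((g r : R)) = r * y := fun r => rfl
  have hle : Submodule.submoduleOf (A ⊔ Ideal.span {x}) _ ≤
      (Submodule.submoduleOf (A ⊔ Ideal.span {x * y}) _).comap g := fun r hr => (hmem r).2 hr
  refine (LinearEquiv.ofBijective (Submodule.mapQ _ _ g hle) ⟨?_, ?_⟩).length_eq
  · rw [← LinearMap.ker_eq_bot, LinearMap.ker_eq_bot']
    intro u hu
    obtain ⟨u, rfl⟩ := Submodule.Quotient.mk_surjective _ u
    rw [Submodule.mapQ_apply, Submodule.Quotient.mk_eq_zero] at hu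
    rw [Submodule.Quotient.mk_eq_zero]
    exact (hmem u).1 hu
  · intro w
    obtain ⟨⟨w, hw⟩, rfl⟩ := Submodule.Quotient.mk_surjective _ w
    obtain ⟨a, ha, t, h⟩ := mem_sup_span_singleton.1 (Submodule.mem_colon.1 hw x hx)
    have hwt : w - t * y ∈ A := hrx _ <| by
      rw [smul_eq_mul] at h
      rwa [show (w - t * y) * x = a by linear_combination h]
    have ht : t * y ∈ (A ⊔ Ideal.span {x * y}).colon (I : Set R) := by
      have : w - t * y ∈ (A ⊔ Ideal.span {x * y}).colon (I : Set R) :=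
        Ideal.le_colon (Submodule.mem_sup_left hwt)
      simpa using Ideal.sub_mem _ hw this
    refine ⟨Submodule.Quotient.mk ⟨t, (hcol t).1 ht⟩, ?_⟩
    rw [Submodule.mapQ_apply, eq_comm, Submodule.Quotient.eq]
    exact Submodule.mem_sup_left hwt

theorem length_colon_sup_span_eq {A I : Ideal R} {x y : R} (hx : x ∈ I) (hy : y ∈ I)
    (hrx : IsRegularMod A x) (hry : IsRegularMod A y) :
    Module.length R (IdealQuot ((A ⊔ Ideal.span {x}).colon (I : Set R)) (A ⊔ Ideal.span {x})) =
    Module.length R (IdealQuot ((A ⊔ Ideal.span {y}).colon (I : Set R)) (A ⊔ Ideal.span {y})) := by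
  rw [length_colon_sup_span_mul hx hrx hry, mul_comm, length_colon_sup_span_mul hy hry hrx]

/-- Whether I contains a further regular element does not depend on the element divided out: it is
the vanishing of a length that the exchange preserves. -/
theorem colon_sup_span_le {A I : Ideal R} {x y : R} (hx : x ∈ I) (hy : y ∈ I)
    (hrx : IsRegularMod A x) (hry : IsRegularMod A y)
    (h : (A ⊔ Ideal.span {x}).colon (I : Set R) ≤ A ⊔ Ideal.span {x}) :
    (A ⊔ Ideal.span {y}).colon (I : Set R) ≤ A ⊔ Ideal.span {y} := by
  rw [← subsingleton_idealQuot_iff, ← Module.length_eq_zero_iff (R := R)] at h ⊢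
  rw [← h, length_colon_sup_span_eq hx hy hrx hry]

theorem IsRegularMod.sup_span_swap {A : Ideal R} {x z : R} (hx : IsRegularMod A x)
    (hz : IsRegularMod (A ⊔ Ideal.span {x}) z) : IsRegularMod (A ⊔ Ideal.span {z}) x := by
  intro u hu
  obtain ⟨a, ha, t, h⟩ := mem_sup_span_singleton.1 hu
  obtain ⟨a', ha', s, rfl⟩ := mem_sup_span_singleton.1 <|
    hz t (mem_sup_span_singleton.2 ⟨-a, A.neg_mem ha, u, by linear_combination -h⟩)
  refine mem_sup_span_singleton.2 ⟨u - s * z, hx _ ?_, s, by ring⟩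
  rw [show (u - s * z) * x = a + a' * z by linear_combination h]
  exact A.add_mem ha (A.mul_mem_right _ ha')

variable [IsLocalRing R] [IsNoetherianRing R]

theorem IsRegularMod.of_sup_span {A : Ideal R} {x z : R} (hxm : x ∈ maximalIdeal R)
    (hx : IsRegularMod A x) (hz : IsRegularMod (A ⊔ Ideal.span {x}) z) : IsRegularMod A z := by
  have hle : A.colon {z} ≤ A ⊔ maximalIdeal R • A.colon {z} := by
    intro u hu
    rw [Submodule.mem_colon_singleton, smul_eq_mul] at hu
    obtain ⟨a, ha, t, rfl⟩ := mem_sup_span_singleton.1 (hz u (Submodule.mem_sup_left hu))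
    refine Submodule.add_mem_sup ha ?_
    rw [mul_comm t x, ← smul_eq_mul]
    refine Submodule.smul_mem_smul hxm ?_
    rw [Submodule.mem_colon_singleton, smul_eq_mul]
    refine hx _ ?_
    have := A.sub_mem hu (A.mul_mem_right z ha)
    convert this using 1
    ring
  have := Submodule.le_of_le_smul_of_le_jacobson_bot (IsNoetherian.noetherian _)
    (maximalIdeal_le_jacobson _) hle
  exact fun u hu => this (Submodule.mem_colon_singleton.2 hu)

/-- The link is some v in I regular after both x and z. Induction over A + x continues x, v to a
full sequence; x and v commute; induction over A + v replaces x by z; then v and z commute back. -/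
theorem exists_isRegularSeqMod_cons {I : Ideal R} (hI : I ≤ maximalIdeal R) {A : Ideal R}
    {x z : R} {l : List R} (hl : IsRegularSeqMod A (x :: l)) (hxI : x ∈ I) (hlI : ∀ r ∈ l, r ∈ I)
    (hz : IsRegularMod A z) (hzI : z ∈ I) :
    ∃ t : List R, t.length = l.length ∧ (∀ r ∈ t, r ∈ I) ∧ IsRegularSeqMod A (z :: t) := by
  induction hn : l.length generalizing A x z l with
  | zero => exact ⟨[], rfl, by simp, hz, trivial⟩
  | succ n ih =>
    obtain ⟨w, l, rfl⟩ := List.exists_cons_of_length_eq_add_one hn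
    obtain ⟨hx, hw, hl⟩ := hl
    simp only [List.mem_cons, forall_eq_or_imp, List.length_cons, Nat.add_right_cancel_iff]
      at hlI hn
    have hcx := colon_le_of_isRegularMod hlI.1 hw
    obtain ⟨v, hvI, hvx, hvz⟩ := exists_isRegularMod_mem hcx (colon_sup_span_le hxI hzI hx hz hcx)
    obtain ⟨t₁, ht₁, ht₁I, -, hr₁⟩ := ih ⟨hw, hl⟩ hlI.1 hlI.2 hvx hvI hn
    have hv := IsRegularMod.of_sup_span (hI hxI) hx hvx
    obtain ⟨t₂, ht₂, ht₂I, hr₂⟩ := ih (A := A ⊔ Ideal.span {v}) (x := x) (z := z) (l := t₁)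
      ⟨hx.sup_span_swap hvx, by rwa [sup_right_comm]⟩ hxI ht₁I (hz.sup_span_swap hvz) hzI ht₁
    refine ⟨v :: t₂, by simp [ht₂], by simpa using ⟨hvI, ht₂I⟩, hz, hvz, ?_⟩
    rw [sup_right_comm]
    exact hr₂.2

/-- The length of `Hom(R/I, R/(A + l))` is the same for all regular sequences `l` on `R/A` in `I` of
the same length. -/
theorem length_colon_sup_ofList_eq {I : Ideal R} (hI : I ≤ maximalIdeal R) {A : Ideal R}
    {l l' : List R} (hl : IsRegularSeqMod A l) (hlI : ∀ r ∈ l, r ∈ I)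
    (hl' : IsRegularSeqMod A l') (hlI' : ∀ r ∈ l', r ∈ I) (hlen : l'.length = l.length) :
    Module.length R
      (IdealQuot ((A ⊔ Ideal.ofList l).colon (I : Set R)) (A ⊔ Ideal.ofList l)) =
    Module.length R
      (IdealQuot ((A ⊔ Ideal.ofList l').colon (I : Set R)) (A ⊔ Ideal.ofList l')) := by
  induction hn : l.length generalizing A l l' with
  | zero =>
    rw [hn] at hlen
    rw [List.length_eq_zero_iff] at hn hlen
    rw [hn, hlen]
  | succ n ih =>
    rw [hn] at hlen
    obtain ⟨x, l, rfl⟩ := List.exists_cons_of_length_eq_add_one hn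
    obtain ⟨y, l', rfl⟩ := List.exists_cons_of_length_eq_add_one hlen
    simp only [List.mem_cons, forall_eq_or_imp, List.length_cons, Nat.add_right_cancel_iff]
      at hlI hn hlI' hlen
    obtain ⟨hx, hl⟩ := hl
    obtain ⟨hy, hl'⟩ := hl'
    -- Length one is the direct exchange. From length two on, the second elements guarantee a v in I
    -- regular after both x and y.
    rcases n with _ | n
    · rw [List.length_eq_zero_iff] at hn hlen
      subst hn hlen
      rw [Ideal.ofList_singleton, Ideal.ofList_singleton]
      exact length_colon_sup_span_eq hlI.1 hlI'.1 hx hy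
    · obtain ⟨w, l₂, hwl⟩ := List.exists_cons_of_length_eq_add_one hn
      obtain ⟨w', l₂', hwl'⟩ := List.exists_cons_of_length_eq_add_one hlen
      have hcx : (A ⊔ Ideal.span {x}).colon (I : Set R) ≤ A ⊔ Ideal.span {x} :=
        colon_le_of_isRegularMod (hlI.2 w (by simp [hwl])) (hwl ▸ hl).1
      have hcy : (A ⊔ Ideal.span {y}).colon (I : Set R) ≤ A ⊔ Ideal.span {y} :=
        colon_le_of_isRegularMod (hlI'.2 w' (by simp [hwl'])) (hwl' ▸ hl').1
      obtain ⟨v, hvI, hvx, hvy⟩ := exists_isRegularMod_mem hcx hcy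
      obtain ⟨t, ht, htI, hrt⟩ := exists_isRegularSeqMod_cons hI (hwl ▸ hl)
        (hlI.2 w (by simp [hwl])) (fun r hr => hlI.2 r (by simp [hwl, hr])) hvx hvI
      obtain ⟨t', ht', htI', hrt'⟩ := exists_isRegularSeqMod_cons hI (hwl' ▸ hl')
        (hlI'.2 w' (by simp [hwl'])) (fun r hr => hlI'.2 r (by simp [hwl', hr])) hvy hvI
      have hlen₁ : t.length = n := by rw [ht]; simpa [hwl] using hn
      have hlen₂ : t'.length = n := by rw [ht']; simpa [hwl'] using hlen
      have e₁ := ih hl hlI.2 hrt (by simpa using ⟨hvI, htI⟩) (by simp [hn, hlen₁]) hn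
      have e₂ := ih hl' hlI'.2 hrt' (by simpa using ⟨hvI, htI'⟩) (by simp [hlen, hlen₂]) hlen
      -- With v moved to the front, what remains are sequences one shorter over A + v, starting with
      -- x and y.
      have e₃ := ih (A := A ⊔ Ideal.span {v}) (l := x :: t) (l' := y :: t')
        ⟨hx.sup_span_swap hvx, by rw [sup_right_comm]; exact hrt.2⟩
        (by simpa using ⟨hlI.1, htI⟩)
        ⟨hy.sup_span_swap hvy, by rw [sup_right_comm]; exact hrt'.2⟩
        (by simpa using ⟨hlI'.1, htI'⟩) (by simp [hlen₁, hlen₂]) (by simp [hlen₁])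
      have q : ∀ (B : Ideal R) (r : R) (s : List R),
          B ⊔ Ideal.ofList (r :: s) = B ⊔ Ideal.span {r} ⊔ Ideal.ofList s := fun B r s => by
        rw [Ideal.ofList_cons, sup_assoc]
      rw [q, q] at e₃
      rw [q _ v] at e₁ e₂
      rw [q, q, e₁, e₂, sup_right_comm A (Ideal.span {x}), e₃, sup_right_comm A (Ideal.span {v})]

end Exchange

/-! ### Systems of parameters are regular sequences -/

section SystemsOfParameters

variable {R : Type*} [CommRing R] [IsLocalRing R] [IsNoetherianRing R]

/-- Induction on the sequence: R/(A + z) has an associated prime Q containing P and z, and z ∉ P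
makes the dimension drop strictly from R/P to R/Q. -/
theorem length_le_ringKrullDim_quotient_associatedPrime {A : Ideal R} {l : List R}
    (hl : IsRegularSeqMod A l) (hlm : ∀ r ∈ l, r ∈ maximalIdeal R) {P : Ideal R}
    (hP : IsAssociatedPrime P (R ⧸ A)) : (l.length : WithBot ℕ∞) ≤ ringKrullDim (R ⧸ P) := by
  induction l generalizing A P with
  | nil =>
    have := hP.isPrime
    simpa using ringKrullDim_nonneg_of_nontrivial
  | cons z l ih =>
    simp only [List.mem_cons, forall_eq_or_imp] at hlm
    obtain ⟨hz, hl⟩ := hl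
    have hPp := hP.isPrime
    obtain ⟨-, x, hx⟩ := isAssociatedPrime_iff.1 hP
    obtain ⟨x, rfl⟩ := Submodule.Quotient.mk_surjective _ x
    have hxP : ∀ r, r ∈ P ↔ r * x ∈ A := fun r => by
      rw [hx, Submodule.mem_colon_singleton, ← Submodule.Quotient.mk_smul, Submodule.mem_bot,
        Submodule.Quotient.mk_eq_zero, smul_eq_mul]
    have hxA : x ∉ A := fun h => hPp.ne_top <| (Ideal.eq_top_iff_one _).2 <| by
      rw [hxP]; simpa using h
    have hzP : z ∉ P := fun h => hxA <| hz x <| by rw [mul_comm]; exact (hxP z).1 h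
    -- If A : P ⊆ A + (z), regularity of z gives A : P = A + z(A : P), hence A : P ⊆ A by Nakayama,
    -- although x lies in A : P and not in A.
    obtain ⟨b, hbP, hb⟩ : ∃ b ∈ A.colon (P : Set R), b ∉ A ⊔ Ideal.span {z} := by
      by_contra! hcon
      refine hxA ?_
      have hle : A.colon (P : Set R) ≤ A ⊔ maximalIdeal R • A.colon (P : Set R) := by
        intro u hu
        obtain ⟨a, ha, t, rfl⟩ := mem_sup_span_singleton.1 (hcon u hu)
        refine Submodule.add_mem_sup ha ?_
        rw [mul_comm t z, ← smul_eq_mul]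
        refine Submodule.smul_mem_smul hlm.1 (Submodule.mem_colon.2 fun p hp => hz _ ?_)
        have := A.sub_mem (Submodule.mem_colon.1 hu p hp) (A.mul_mem_right p ha)
        convert this using 1
        simp only [smul_eq_mul]
        ring
      exact Submodule.le_of_le_smul_of_le_jacobson_bot (IsNoetherian.noetherian _)
        (maximalIdeal_le_jacobson _) hle (Submodule.mem_colon.2 fun p hp => by
          rw [smul_eq_mul, mul_comm]; exact (hxP p).1 hp)
    obtain ⟨Q, hQ, hle⟩ := exists_le_isAssociatedPrime_of_isNoetherianRing R
      (Submodule.Quotient.mk b : R ⧸ (A ⊔ Ideal.span {z}))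
      (by rwa [ne_eq, Submodule.Quotient.mk_eq_zero])
    have hmem : ∀ r, r * b ∈ A ⊔ Ideal.span {z} → r ∈ Q := fun r hr => hle <| by
      rwa [Submodule.mem_colon_singleton, ← Submodule.Quotient.mk_smul, Submodule.mem_bot,
        Submodule.Quotient.mk_eq_zero, smul_eq_mul]
    have hPQ : P ≤ Q := fun p hp => hmem p <| Submodule.mem_sup_left <| by
      rw [mul_comm]; exact Submodule.mem_colon.1 hbP p hp
    have hzQ : z ∈ Q := hmem z <| Submodule.mem_sup_right <|
      Ideal.mul_mem_right _ _ (Ideal.mem_span_singleton_self z)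
    have hdim := ringKrullDim_succ_le_of_surjective (Ideal.Quotient.factor hPQ)
      (Ideal.Quotient.factor_surjective hPQ) (r := Ideal.Quotient.mk P z)
      (mem_nonZeroDivisors_of_ne_zero (by rwa [ne_eq, Ideal.Quotient.eq_zero_iff_mem]))
      (by rw [Ideal.Quotient.factor_mk, Ideal.Quotient.eq_zero_iff_mem]; exact hzQ)
    refine le_trans ?_ hdim
    have := ih hl hlm.2 hQ
    push_cast [List.length_cons]
    gcongr

/-- Krull's height theorem in R/P, whose maximal ideal is minimal over the images of `y`. -/
theorem ringKrullDim_quotient_prime_le_length {P : Ideal R} [P.IsPrime] {y : List R}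
    (h : maximalIdeal R ≤ (P ⊔ Ideal.ofList y).radical) (hy : ∀ r ∈ y, r ∈ maximalIdeal R) :
    ringKrullDim (R ⧸ P) ≤ y.length := by
  classical
  have : IsLocalRing (R ⧸ P) :=
    .of_surjective' (Ideal.Quotient.mk P) Ideal.Quotient.mk_surjective
  have hmem : ∀ r, Ideal.Quotient.mk P r ∈ maximalIdeal (R ⧸ P) ↔ r ∈ maximalIdeal R := by
    intro r
    refine ⟨fun hr => ?_, fun hr => ?_⟩
    · rw [mem_maximalIdeal] at hr ⊢
      exact fun hu => hr (hu.map _)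
    · rw [mem_maximalIdeal, mem_nonunits_iff]
      rintro hu
      obtain ⟨s, hs⟩ := hu.exists_right_inv
      obtain ⟨s, rfl⟩ := Ideal.Quotient.mk_surjective s
      rw [← map_mul, ← map_one (Ideal.Quotient.mk P), Ideal.Quotient.eq] at hs
      have h1 := le_maximalIdeal (Ideal.IsPrime.ne_top ‹P.IsPrime›) hs
      exact (Ideal.ne_top_iff_one _).1 (Ideal.IsPrime.ne_top' (I := maximalIdeal R))
        (by simpa using Ideal.sub_mem _ (Ideal.mul_mem_right s _ hr) h1)
  rw [← maximalIdeal_height_eq_ringKrullDim]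
  have hmin : maximalIdeal (R ⧸ P) ∈
      (Ideal.span ((y.toFinset.image (Ideal.Quotient.mk P) : Finset (R ⧸ P)) :
        Set (R ⧸ P))).minimalPrimes := by
    refine ⟨⟨inferInstance, ?_⟩, ?_⟩
    · rw [Ideal.span_le]
      intro r hr
      obtain ⟨s, hs, rfl⟩ := Finset.mem_image.1 (Finset.mem_coe.1 hr)
      exact (hmem s).2 (hy s (List.mem_toFinset.1 hs))
    · rintro Q ⟨hQ, hQy⟩ -
      intro r hr
      obtain ⟨r, rfl⟩ := Ideal.Quotient.mk_surjective r
      have hle : (P ⊔ Ideal.ofList y).radical ≤ Q.comap (Ideal.Quotient.mk P) := by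
        rw [(Ideal.IsPrime.comap (Ideal.Quotient.mk P) (K := Q)).radical_le_iff, sup_le_iff]
        constructor
        · intro p hp
          rw [Ideal.mem_comap, Ideal.Quotient.eq_zero_iff_mem.2 hp]
          exact Q.zero_mem
        · rw [Ideal.ofList, Ideal.span_le]
          intro p hp
          exact hQy (Ideal.subset_span (by simpa using ⟨p, hp, rfl⟩))
      exact hle (h ((hmem r).1 hr))
  refine le_trans (WithBot.coe_le_coe.2
    (Ideal.height_le_card_of_mem_minimalPrimes_span_finset hmin)) ?_
  have := (Finset.card_image_le (f := Ideal.Quotient.mk P)).trans y.toFinset_card_le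
  exact_mod_cast this

/-- If `R/A` carries a regular sequence of length `d`, then every sequence of `d` elements which is
primary to the maximal ideal is regular. -/
theorem isRegularSeqMod_of_maximalIdeal_le_radical {A : Ideal R} {l y : List R}
    (hl : IsRegularSeqMod A l) (hlm : ∀ r ∈ l, r ∈ maximalIdeal R)
    (hlen : y.length = l.length) (hym : ∀ r ∈ y, r ∈ maximalIdeal R)
    (hy : maximalIdeal R ≤ (A ⊔ Ideal.ofList y).radical) : IsRegularSeqMod A y := by
  induction y generalizing A l with
  | nil => trivial
  | cons z y ih =>
    obtain ⟨x, l, rfl⟩ := List.exists_cons_of_length_eq_add_one hlen.symm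
    simp only [List.mem_cons, forall_eq_or_imp, List.length_cons, Nat.add_right_cancel_iff]
      at hlm hlen hym
    have hz : IsRegularMod A z := by
      intro u hu
      by_contra huA
      have huz : z ∈ ⋃ p ∈ associatedPrimes R (R ⧸ A), (p : Set R) := by
        rw [biUnion_associatedPrimes_eq_zero_divisors]
        refine ⟨Submodule.Quotient.mk u, ?_, ?_⟩
        · rwa [ne_eq, Submodule.Quotient.mk_eq_zero]
        · rw [← Submodule.Quotient.mk_smul, Submodule.Quotient.mk_eq_zero, smul_eq_mul, mul_comm]
          exact hu
      obtain ⟨P, hP, hzP⟩ := Set.mem_iUnion₂.1 huz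
      have hPp : P.IsPrime := IsAssociatedPrime.isPrime hP
      have hAP : A ≤ P := by
        obtain ⟨-, v, rfl⟩ := isAssociatedPrime_iff.1 hP
        obtain ⟨v, rfl⟩ := Submodule.Quotient.mk_surjective _ v
        intro a ha
        rw [Submodule.mem_colon_singleton, ← Submodule.Quotient.mk_smul, Submodule.mem_bot,
          Submodule.Quotient.mk_eq_zero, smul_eq_mul]
        exact A.mul_mem_right v ha
      -- If z lies in P, the remaining elements `y` are primary to m modulo P, so dim R/P is less
      -- than the length of the given regular sequence, against its lower bound.
      have h₁ := length_le_ringKrullDim_quotient_associatedPrime hl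
        (by simpa using hlm) hP
      have h₂ := ringKrullDim_quotient_prime_le_length (P := P) (y := y) (hy.trans <|
        Ideal.radical_mono <| by
          rw [Ideal.ofList_cons]
          exact sup_le (hAP.trans le_sup_left) (sup_le
            ((Ideal.span_singleton_le_iff_mem _).2 (Submodule.mem_sup_left hzP)) le_sup_right))
        hym.2
      have h₃ := h₁.trans h₂
      rw [hlen, List.length_cons] at h₃
      have : l.length + 1 ≤ l.length := by exact_mod_cast h₃
      omega
    obtain ⟨t, ht, htm, hzt⟩ := exists_isRegularSeqMod_cons le_rfl hl hlm.1 hlm.2 hz hym.1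
    refine ⟨hz, ih hzt.2 htm (hlen.trans ht.symm) hym.2 ?_⟩
    rwa [Ideal.ofList_cons, ← sup_assoc] at hy

end SystemsOfParameters

/-! ### Values of homogeneous polynomials -/

section Homogeneous

open MvPolynomial

variable {R : Type*} [CommRing R]

theorem eval_mul_of_isHomogeneous {σ : Type*} [Fintype σ] {f : MvPolynomial σ R} {n : ℕ}
    (hf : f.IsHomogeneous n) (c : R) (w : σ → R) :
    eval (fun i => c * w i) f = c ^ n * eval w f := by
  rw [eval_eq', eval_eq', Finset.mul_sum]
  refine Finset.sum_congr rfl fun α hα => ?_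
  have hd : α.degree = n := by
    by_contra h
    exact (mem_support_iff.1 hα) (hf.coeff_eq_zero h)
  rw [← hd, Finsupp.degree_eq_sum, ← Finset.prod_pow_eq_pow_sum]
  simp only [mul_pow, Finset.prod_mul_distrib]
  ring

theorem multiset_prod_map_mem_pow {σ : Type*} {J : Ideal R} {u : σ → R} (hu : ∀ i, u i ∈ J)
    (t : Multiset σ) : (t.map u).prod ∈ J ^ t.card := by
  induction t using Multiset.induction with
  | empty => simp
  | cons i t ih =>
    rw [Multiset.map_cons, Multiset.prod_cons, Multiset.card_cons, pow_succ']
    exact Ideal.mul_mem_mul (hu i) ih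

/-- Telescoping: replacing u by v one factor at a time leaves one factor in K and n factors in J. -/
theorem multiset_prod_map_sub_mem {σ : Type*} {J K : Ideal R} {u v : σ → R}
    (hu : ∀ i, u i ∈ J) (hv : ∀ i, v i ∈ J) (huv : ∀ i, u i - v i ∈ K) (n : ℕ)
    (t : Multiset σ) (ht : t.card = n + 1) : (t.map u).prod - (t.map v).prod ∈ K * J ^ n := by
  induction n generalizing t with
  | zero =>
    obtain ⟨i, rfl⟩ := Multiset.card_eq_one.1 ht
    simpa using huv i
  | succ n ih =>
    obtain ⟨i, t, rfl⟩ := Multiset.exists_mem_of_ne_zero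
      (s := t) (by rintro rfl; simp at ht) |>.imp fun i hi => Multiset.exists_cons_of_mem hi
    rw [Multiset.card_cons, Nat.add_right_cancel_iff] at ht
    simp only [Multiset.map_cons, Multiset.prod_cons]
    have h₁ : (u i - v i) * (t.map u).prod ∈ K * J ^ (n + 1) :=
      Ideal.mul_mem_mul (huv i) (ht ▸ multiset_prod_map_mem_pow hu t)
    have h₂ : v i * ((t.map u).prod - (t.map v).prod) ∈ K * J ^ (n + 1) := by
      rw [pow_succ', mul_left_comm]
      exact Ideal.mul_mem_mul (hv i) (ih t ht)
    convert Ideal.add_mem _ h₁ h₂ using 1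
    ring

theorem prod_pow_eq_multiset_prod {σ : Type*} [Fintype σ] (α : σ →₀ ℕ) (u : σ → R) :
    ∏ i, u i ^ α i = ((Finsupp.toMultiset α).map u).prod := by
  classical
  rw [Finsupp.toMultiset_map, Finsupp.prod_toMultiset, Finsupp.prod_mapDomain_index (by simp)
    (by intros; rw [pow_add]), Finsupp.prod_fintype _ _ (by simp)]

theorem card_toMultiset_eq_degree {σ : Type*} (α : σ →₀ ℕ) :
    (Finsupp.toMultiset α).card = α.degree := by
  rw [Finsupp.card_toMultiset, Finsupp.degree_apply]
  rfl

theorem eval_sub_eval_mem {σ : Type*} [Fintype σ] {J K : Ideal R} {u v : σ → R}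
    (hu : ∀ i, u i ∈ J) (hv : ∀ i, v i ∈ J) (huv : ∀ i, u i - v i ∈ K) {n : ℕ}
    {f : MvPolynomial σ R} (hf : f.IsHomogeneous (n + 1)) :
    eval u f - eval v f ∈ K * J ^ n := by
  rw [eval_eq', eval_eq', ← Finset.sum_sub_distrib]
  refine Ideal.sum_mem _ fun α hα => ?_
  have hd : α.degree = n + 1 := by
    by_contra h
    exact (mem_support_iff.1 hα) (hf.coeff_eq_zero h)
  rw [← mul_sub, prod_pow_eq_multiset_prod, prod_pow_eq_multiset_prod]
  exact Ideal.mul_mem_left _ _ (multiset_prod_map_sub_mem hu hv huv n _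
    (by rw [card_toMultiset_eq_degree, hd]))

end Homogeneous

/-! ### Reductions and their number of generators -/

section Reductions

variable {R : Type*} [CommRing R]

theorem IsReductionOf.pow_eq {I J : Ideal R} {m : ℕ} (h : I ^ (m + 1) = J * I ^ m) (n : ℕ) :
    I ^ (n + m) = J ^ n * I ^ m := by
  induction n with
  | zero => simp
  | succ n ih =>
    rw [show n + 1 + m = n + (m + 1) by ring, pow_add, h, mul_left_comm, ← pow_add, ih, pow_succ',
      mul_assoc]

theorem IsReductionOf.trans {I J K : Ideal R} (hK : IsReductionOf K J) (hJ : IsReductionOf J I) :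
    IsReductionOf K I := by
  obtain ⟨hKJ, n, hn⟩ := hK
  obtain ⟨hJI, m, hm⟩ := hJ
  refine ⟨hKJ.trans hJI, n + m, ?_⟩
  rw [IsReductionOf.pow_eq hm n, show n + m + 1 = n + 1 + m by ring,
    IsReductionOf.pow_eq hm (n + 1), hn, mul_assoc]

theorem IsReductionOf.radical_le {I J : Ideal R} (h : IsReductionOf J I) :
    I.radical ≤ J.radical := by
  obtain ⟨-, n, hn⟩ := h
  rw [← Ideal.radical_pow I n.succ_ne_zero, hn]
  exact Ideal.radical_mono Ideal.mul_le_left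

theorem length_quotient_le_of_le {A B : Ideal R} (h : A ≤ B) :
    Module.length R (R ⧸ B) ≤ Module.length R (R ⧸ A) :=
  Module.length_le_of_surjective (Submodule.factor h) (Submodule.factor_surjective h)

variable [IsLocalRing R]

open MvPolynomial in
/-- If the monomials in `a` are independent modulo `m J ^ n`, then they give a lower bound for the
length of `R / J ^ (N + 1)`. -/
theorem card_le_length_quotient_pow {J : Ideal R} (hJ : J ≤ maximalIdeal R) {s : ℕ} {a : Fin s → R}
    (haJ : ∀ i, a i ∈ J)
    (hind : ∀ (n : ℕ) (f : MvPolynomial (Fin s) R), f.IsHomogeneous n →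
      eval a f ∈ maximalIdeal R * J ^ n → ∀ α, coeff α f ∈ maximalIdeal R) {N : ℕ}
    (T : Finset (Fin s →₀ ℕ)) (hT : ∀ α ∈ T, α.degree ≤ N) :
    (T.card : ℕ∞) ≤ Module.length R (R ⧸ J ^ (N + 1)) := by
  classical
  let mon : (Fin s →₀ ℕ) → R := fun α => ∏ i, a i ^ α i
  have hmon : ∀ α, mon α ∈ J ^ α.degree := fun α => by
    rw [show mon α = _ from prod_pow_eq_multiset_prod α a, ← card_toMultiset_eq_degree]
    exact multiset_prod_map_mem_pow haJ _
  -- Each new monomial strictly enlarges the ideal, so the colength drops by at least one. Monomials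
  -- enter by decreasing degree: those of degree above n = deg α lie in m J^n, and those of degree n
  -- would give a forbidden relation with coefficient 1 at α.
  suffices h : (T.card : ℕ∞) +
      Module.length R (R ⧸ (J ^ (N + 1) ⊔ Ideal.span (mon '' (T : Set (Fin s →₀ ℕ))))) ≤
      Module.length R (R ⧸ J ^ (N + 1)) from le_self_add.trans h
  induction T using Finset.induction_on_min_value (fun α : Fin s →₀ ℕ => α.degree) with
  | empty => rw [Finset.coe_empty, Set.image_empty, Ideal.span_empty, sup_bot_eq]; simp
  | insert α T hαT hmin ih =>
    simp only [Finset.mem_insert, forall_eq_or_imp] at hT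
    refine le_trans ?_ (ih hT.2)
    set B := J ^ (N + 1) ⊔ Ideal.span (mon '' (T : Set (Fin s →₀ ℕ)))
    set B' := J ^ (N + 1) ⊔ Ideal.span (mon '' ((insert α T : Finset _) : Set (Fin s →₀ ℕ)))
      with hB'
    have hBB' : B ≤ B' := sup_le_sup_left (Ideal.span_mono (Set.image_mono (by simp))) _
    have hα : mon α ∉ B := by
      intro hmem
      set n := α.degree
      have hle : B ≤ maximalIdeal R * J ^ n ⊔
          Ideal.span (mon '' ((T.filter fun β => β.degree = n : Finset _) : Set _)) := by
        have hpow : ∀ k, n < k → J ^ k ≤ maximalIdeal R * J ^ n := fun k hk => by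
          refine (Ideal.pow_le_pow_right (Nat.succ_le_of_lt hk)).trans ?_
          rw [pow_succ']
          exact Ideal.mul_mono_left hJ
        refine sup_le ((hpow _ (by omega)).trans le_sup_left) ?_
        rw [Ideal.span_le]
        rintro _ ⟨β, hβ, rfl⟩
        rcases (hmin β hβ).eq_or_lt with h | h
        · exact Ideal.mem_sup_right (Ideal.subset_span ⟨β, by simpa using ⟨hβ, h.symm⟩, rfl⟩)
        · exact Ideal.mem_sup_left (hpow _ h (hmon β))
      obtain ⟨e, he, g, hg, hsum⟩ := Submodule.mem_sup.1 (hle hmem)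
      obtain ⟨c, hc⟩ := (Submodule.mem_span_image_finset_iff_exists_fun' R).1 hg
      let f : MvPolynomial (Fin s) R := monomial α 1 -
        ∑ β ∈ T.filter fun β => β.degree = n, monomial β (c β)
      have hf : f.IsHomogeneous n := (isHomogeneous_monomial _ rfl).sub <|
        IsHomogeneous.sum _ _ _ fun β hβ =>
          isHomogeneous_monomial _ (Finset.mem_filter.1 hβ).2
      have hev : eval a f = e := by
        have : ∀ β : Fin s →₀ ℕ, ∀ r, eval a (monomial β r) = r * mon β := fun β r => by
          rw [eval_monomial, Finsupp.prod_fintype _ _ (by simp)]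
        simp only [f, map_sub, map_sum, this]
        simp only [smul_eq_mul] at hc
        rw [hc, one_mul, ← hsum, add_sub_cancel_right]
      have hco : coeff α f = 1 := by
        simp only [f, coeff_sub, coeff_sum, coeff_monomial, if_true]
        rw [Finset.sum_eq_zero, sub_zero]
        intro β hβ
        rw [if_neg]
        rintro rfl
        exact hαT (Finset.mem_filter.1 hβ).1
      have := hind n f hf (hev ▸ he) α
      rw [hco] at this
      exact (Ideal.ne_top_iff_one _).1 (Ideal.IsPrime.ne_top' (I := maximalIdeal R)) this
    have hone : 1 ≤ Module.length R (IdealQuot B' B) := by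
      rw [Order.one_le_iff_ne_zero, ne_eq, Module.length_eq_zero_iff, subsingleton_idealQuot_iff]
      exact fun h => hα (h (Ideal.mem_sup_right (Ideal.subset_span ⟨α, by simp, rfl⟩)))
    rw [Finset.card_insert_of_notMem hαT, length_quotient_eq_add_idealQuot hBB']
    push_cast
    rw [add_assoc]
    gcongr

variable [IsNoetherianRing R]

open MvPolynomial in
/-- Over an infinite residue field, a relation between the generators of a reduction in the fiber
cone allows to drop one generator after a linear change of variables. -/
theorem exists_reduction_of_relation [Infinite (ResidueField R)] {J : Ideal R} {s : ℕ}
    {a : Fin s → R} (ha : IsReductionOf (Ideal.span (Set.range a)) J)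
    {n : ℕ} {f : MvPolynomial (Fin s) R} (hf : f.IsHomogeneous n)
    (hfa : eval a f ∈ maximalIdeal R * J ^ n) {α : Fin s →₀ ℕ}
    (hα : coeff α f ∉ maximalIdeal R) :
    ∃ t < s, ∃ b : Fin t → R, IsReductionOf (Ideal.span (Set.range b)) J := by
  have haJ : ∀ i, a i ∈ J := fun i => ha.1 (Ideal.subset_span ⟨i, rfl⟩)
  -- In degree 0 the form is a constant, and its value lies in m only if its coefficient does.
  rcases n with _ | n
  · have hfC := (totalDegree_eq_zero_iff_eq_C).1 ((totalDegree_zero_iff_isHomogeneous _).2 hf)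
    have h0 : coeff 0 f ∈ maximalIdeal R := by
      rw [hfC] at hfa
      simpa using hfa
    by_cases hα0 : α.degree = 0
    · rw [Finsupp.degree_eq_zero_iff] at hα0
      exact absurd (hα0 ▸ h0) hα
    · rw [hf.coeff_eq_zero hα0] at hα
      exact absurd (zero_mem _) hα
  have hne : map (residue R) f ≠ 0 := fun h => by
    have := congrArg (coeff α) h
    rw [coeff_map, coeff_zero, residue_eq_zero_iff] at this
    exact hα this
  obtain ⟨p, hp⟩ : ∃ p, eval p (map (residue R) f) ≠ 0 := by
    by_contra! h
    exact hne (MvPolynomial.funext fun p => by rw [h p, map_zero])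
  have hfh := hf.map (residue R)
  obtain ⟨i₀, hi₀⟩ : ∃ i, p i ≠ 0 := by
    by_contra! h
    refine hp ?_
    have := eval_mul_of_isHomogeneous hfh 0 p
    simp only [zero_mul, ne_eq, Nat.add_eq_zero_iff, one_ne_zero, and_false, not_false_eq_true,
      zero_pow] at this
    rwa [show p = fun _ => 0 from _root_.funext h]
  -- The nonroot p is rescaled to have coordinate 1 at i₀ and then lifted to R, so that both `w₀ i₀`
  -- and f(w₀) are units.
  choose w₀ hw₀ using fun i => residue_surjective (R := R) ((p i₀)⁻¹ * p i)
  have hw : IsUnit (eval w₀ f) := by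
    rw [← residue_ne_zero_iff_isUnit]
    have h1 : residue R (eval w₀ f) = eval (fun i => (p i₀)⁻¹ * p i) (map (residue R) f) := by
      rw [eval_map, eval₂_eq', eval_eq', map_sum]
      refine Finset.sum_congr rfl fun β _ => ?_
      rw [map_mul, map_prod]
      simp only [map_pow, hw₀]
    rw [h1, eval_mul_of_isHomogeneous hfh]
    exact mul_ne_zero (pow_ne_zero _ (inv_ne_zero hi₀)) hp
  obtain ⟨t, rfl⟩ : ∃ t, s = t + 1 := Nat.exists_eq_succ_of_ne_zero (by
    rintro rfl; exact i₀.elim0)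
  have hwi : IsUnit (w₀ i₀) := by
    rw [← residue_ne_zero_iff_isUnit, hw₀, inv_mul_cancel₀ hi₀]
    exact one_ne_zero
  obtain ⟨y, hy⟩ := hwi.exists_right_inv
  -- Modulo these elements each `a i` is `w₀ i` times `y * a i₀`, so f(a) becomes a unit times `a i₀
  -- ^ (n + 1)`. That power therefore lies in K J^n + m J^(n+1), and Nakayama removes the second
  -- term.
  let b : Fin t → R := fun j => a (i₀.succAbove j) - w₀ (i₀.succAbove j) * (y * a i₀)
  set K := Ideal.span (Set.range b) with hK
  have hbK : ∀ i, a i - y * a i₀ * w₀ i ∈ K := by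
    intro i
    by_cases hi : i = i₀
    · subst hi
      have : a i - y * a i * w₀ i = 0 := by linear_combination -a i * hy
      rw [this]
      exact zero_mem _
    · obtain ⟨j, rfl⟩ := Fin.exists_succAbove_eq hi
      refine Ideal.subset_span ⟨j, ?_⟩
      simp only [b]
      ring
  have hKa : K ≤ Ideal.span (Set.range a) := by
    rw [hK, Ideal.span_le]
    rintro _ ⟨j, rfl⟩
    exact Ideal.sub_mem _ (Ideal.subset_span ⟨_, rfl⟩)
      (Ideal.mul_mem_left _ _ (Ideal.mul_mem_left _ _ (Ideal.subset_span ⟨_, rfl⟩)))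
  have hKJ := hKa.trans ha.1
  have hpow : a i₀ ^ (n + 1) ∈ K * J ^ n ⊔ maximalIdeal R * J ^ (n + 1) := by
    have h1 := eval_sub_eval_mem (v := fun i => y * a i₀ * w₀ i) haJ
      (fun i => Ideal.mul_mem_right _ _ (Ideal.mul_mem_left _ _ (haJ i₀))) hbK hf
    rw [eval_mul_of_isHomogeneous hf, mul_pow] at h1
    have hu : IsUnit (y ^ (n + 1) * eval w₀ f) :=
      ((IsUnit.of_mul_eq_one _ (by rwa [mul_comm])).pow _).mul hw
    have h2 : (y ^ (n + 1) * eval w₀ f) * a i₀ ^ (n + 1) ∈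
        K * J ^ n ⊔ maximalIdeal R * J ^ (n + 1) := by
      have := Ideal.sub_mem _ (Submodule.mem_sup_right (S := K * J ^ n) hfa)
        (Submodule.mem_sup_left (T := maximalIdeal R * J ^ (n + 1)) h1)
      convert this using 1
      ring
    obtain ⟨v, hv⟩ := hu.exists_left_inv
    have := Ideal.mul_mem_left _ v h2
    rwa [← mul_assoc, hv, one_mul] at this
  have hspan : Ideal.span (Set.range a) = Ideal.span {a i₀} ⊔ K := by
    refine le_antisymm ?_ (sup_le ?_ hKa)
    · rw [Ideal.span_le]
      rintro _ ⟨i, rfl⟩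
      have h1 : a i = y * w₀ i * a i₀ + (a i - y * a i₀ * w₀ i) := by ring
      rw [h1]
      exact Ideal.add_mem _ (Ideal.mem_sup_left (Ideal.mul_mem_left _ _
        (Ideal.mem_span_singleton_self _))) (Ideal.mem_sup_right (hbK i))
    · exact (Ideal.span_singleton_le_iff_mem _).2 (Ideal.subset_span ⟨_, rfl⟩)
  have hspanpow : Ideal.span (Set.range a) ^ (n + 1) ≤
      K * J ^ n ⊔ maximalIdeal R * J ^ (n + 1) := by
    rw [hspan, sup_pow_succ_eq, Ideal.span_singleton_pow]
    refine sup_le ((Ideal.span_singleton_le_iff_mem _).2 hpow) ?_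
    rw [← hspan]
    exact (Ideal.mul_mono_right (Ideal.pow_right_mono ha.1 n)).trans le_sup_left
  obtain ⟨-, r, hr⟩ := ha
  refine ⟨t, t.lt_succ_self, b, hKJ, n + r, le_antisymm ?_ ?_⟩
  · refine Submodule.le_of_le_smul_of_le_jacobson_bot (IsNoetherian.noetherian _)
      (maximalIdeal_le_jacobson _) ?_
    calc J ^ (n + r + 1) = Ideal.span (Set.range a) ^ (n + 1) * J ^ r := by
          rw [← IsReductionOf.pow_eq hr (n + 1)]; congr 1; ring
      _ ≤ (K * J ^ n ⊔ maximalIdeal R * J ^ (n + 1)) * J ^ r := Ideal.mul_mono_left hspanpow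
      _ = K * J ^ (n + r) ⊔ maximalIdeal R • J ^ (n + r + 1) := by
          rw [Ideal.sup_mul, mul_assoc, mul_assoc, ← pow_add, ← pow_add, smul_eq_mul,
            show n + 1 + r = n + r + 1 by ring]
  · rw [pow_succ' J]
    exact Ideal.mul_mono_left hKJ

theorem length_quotient_ne_top {A : Ideal R} (hA : maximalIdeal R ≤ A.radical) :
    Module.length R (R ⧸ A) ≠ ⊤ := by
  by_cases htop : A = ⊤
  · subst htop
    rw [Module.length_eq_zero]
    simp
  have hmin : maximalIdeal R ∈ A.minimalPrimes :=
    ⟨⟨inferInstance, le_maximalIdeal htop⟩, fun P hP _ => hA.trans (hP.1.radical_le_iff.2 hP.2)⟩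
  have := quotient_artinian_of_mem_minimalPrimes_of_isLocalRing A hmin
  have : IsArtinian R (R ⧸ A) :=
    isArtinian_of_surjective_algebraMap (R := R ⧸ A) Ideal.Quotient.mk_surjective
  exact Module.length_ne_top

/-- Over an infinite residue field, an ideal primary to the maximal ideal has a reduction generated
by at most `d` elements. -/
theorem exists_reduction_fin [Infinite (ResidueField R)] {l : List R}
    (hl : ∀ l', l'.Perm l → IsRegularSeqMod (⊥ : Ideal R) l') (hlm : ∀ r ∈ l, r ∈ maximalIdeal R)
    (hlr : maximalIdeal R ≤ (Ideal.ofList l).radical) {J : Ideal R} (hJ : J ≤ maximalIdeal R)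
    (hJr : maximalIdeal R ≤ J.radical) :
    ∃ s ≤ l.length, ∃ a : Fin s → R, IsReductionOf (Ideal.span (Set.range a)) J := by
  classical
  have hex : ∃ s, ∃ a : Fin s → R, IsReductionOf (Ideal.span (Set.range a)) J := by
    obtain ⟨s, a, ha⟩ := Submodule.fg_iff_exists_fin_generating_family.1 (IsNoetherian.noetherian J)
    exact ⟨s, a, ha ▸ ⟨le_rfl, 0, by simp⟩⟩
  obtain ⟨a, ha⟩ := Nat.find_spec hex
  refine ⟨Nat.find hex, ?_, a, ha⟩
  have hmin : ∀ t < Nat.find hex, ¬ ∃ b : Fin t → R, IsReductionOf (Ideal.span (Set.range b)) J :=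
    fun t => Nat.find_min hex
  generalize Nat.find hex = s at *
  -- Minimality of s excludes relations in the fiber cone. The box of exponents at most M has (M +
  -- 1)^s monomials, of degree at most sM.
  have hbound := fun M : ℕ => card_le_length_quotient_pow hJ
    (fun i => ha.1 (Ideal.subset_span ⟨i, rfl⟩)) (N := s * M) (fun n f hf hfa α => by
      by_contra hα
      obtain ⟨t, ht, b, hb⟩ := exists_reduction_of_relation ha hf hfa hα
      exact hmin t ht ⟨b, hb⟩)
    ((Fintype.piFinset fun _ : Fin s => Finset.range (M + 1)).map
      Finsupp.equivFunOnFinite.symm.toEmbedding) (by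
      intro α hα
      obtain ⟨β, hβ, rfl⟩ := Finset.mem_map.1 hα
      rw [Finsupp.degree_eq_sum]
      have : ∀ i ∈ Finset.univ, β i ≤ M := fun i _ => by
        have := Fintype.mem_piFinset.1 hβ i
        rw [Finset.mem_range] at this
        omega
      simpa using Finset.sum_le_card_nsmul _ _ _ this)
  obtain ⟨c, hc⟩ := Ideal.exists_pow_le_of_le_radical_of_fg
    (I := Ideal.ofList l) (J := J) (le_trans (by
      rw [Ideal.ofList, Ideal.span_le]; exact hlm) hJr) (IsNoetherian.noetherian _)
  obtain ⟨e, he⟩ := ENat.ne_top_iff_exists.1 (length_quotient_ne_top hlr)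
  refine le_of_forall_pow_le_mul_pow (a := c * s) (b := c + l.length) (c := e) fun M => ?_
  have h₁ := hbound M
  have h₂ : Module.length R (R ⧸ J ^ (s * M + 1)) ≤
      Module.length R (R ⧸ Ideal.ofList l ^ (c * (s * M + 1) + 1)) := by
    refine length_quotient_le_of_le ((Ideal.pow_le_pow_right (Nat.le_succ _)).trans ?_)
    rw [pow_mul]
    exact Ideal.pow_right_mono hc _
  have h₃ := length_quotient_sup_pow hl (c * (s * M + 1))
  rw [bot_sup_eq, bot_sup_eq, ← he] at h₃
  have h₄ := h₁.trans (h₂.trans h₃.le)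
  rw [Finset.card_map, Fintype.card_piFinset_const, Finset.card_range] at h₄
  have h₅ : (M + 1) ^ s ≤ Nat.multichoose (l.length + 1) (c * (s * M + 1)) * e := by
    exact_mod_cast h₄
  calc (M + 1) ^ s ≤ _ := h₅
    _ ≤ (c * (s * M + 1) + l.length) ^ l.length * e := by
        gcongr; exact multichoose_succ_le _ _
    _ = _ := by rw [mul_comm]; congr 2; ring

end Reductions

/-! ### Degree two of the symmetric algebra of a quotient module -/

section SymmetricSquare

variable {R : Type*} [CommRing R] {M N : Type*} [AddCommGroup M] [Module R M] [AddCommGroup N]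
  [Module R N]

open TensorAlgebra in
/-- The linear map on the symmetric algebra which is a given symmetric bilinear map in degree
two. -/
theorem exists_symmetricAlgebra_linearMap (B : M →ₗ[R] M →ₗ[R] N) (hB : ∀ m m', B m m' = B m' m) :
    ∃ β : SymmetricAlgebra R M →ₗ[R] N, ∀ m m',
      β (SymmetricAlgebra.ι R M m * SymmetricAlgebra.ι R M m') = B m m' := by
  -- Let m act on R × M × N by (r, m', n) ↦ (0, r m, B m m'). Symmetry of B makes these operators
  -- commute, so Sym M acts, and the product m m' sends (1, 0, 0) to (0, 0, B m m').
  let T : M →ₗ[R] Module.End R (R × M × N) :=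
    { toFun := fun m => LinearMap.prod 0 (LinearMap.prod
        ((LinearMap.toSpanSingleton R M m) ∘ₗ LinearMap.fst R R (M × N))
        (B m ∘ₗ LinearMap.fst R M N ∘ₗ LinearMap.snd R R (M × N)))
      map_add' := fun m m' => by ext <;> simp
      map_smul' := fun r m => by ext <;> simp }
  have hT : ∀ m p, T m p = (0, p.1 • m, B m p.2.1) := fun m p => rfl
  have hcomm : ∀ m m', T m * T m' = T m' * T m := by
    intro m m'
    refine LinearMap.ext fun p => ?_
    simp [Module.End.mul_apply, hT, hB m m']
  let F : TensorAlgebra R M →ₐ[R] Module.End R (R × M × N) := TensorAlgebra.lift R T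
  have hF : symRingCon R M ≤ RingCon.ker F.toRingHom := by
    refine RingCon.ringConGen_le.2 fun x y h => ?_
    induction h with | mul_comm x y
    rw [RingCon.ker_apply]
    change F _ = F _
    rw [map_mul, map_mul]
    simp only [F, TensorAlgebra.lift_ι_apply]
    exact hcomm x y
  let G : SymmetricAlgebra R M →ₐ[R] Module.End R (R × M × N) :=
    RingCon.liftₐEquiv (symRingCon R M) ⟨F, hF⟩
  have hG : ∀ m, G (SymmetricAlgebra.ι R M m) = T m := fun m =>
    TensorAlgebra.lift_ι_apply T m
  refine ⟨(LinearMap.snd R M N ∘ₗ LinearMap.snd R R (M × N)) ∘ₗ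
    LinearMap.applyₗ (1, 0, 0) ∘ₗ G.toLinearMap, fun m m' => ?_⟩
  simp [hG, hT, Module.End.mul_apply]

theorem exists_symmetricAlgebra_quotient_linearMap (B : M →ₗ[R] M →ₗ[R] N)
    (hB : ∀ m m', B m m' = B m' m) (P : Submodule R M) (hP : ∀ p ∈ P, ∀ m, B p m = 0) :
    ∃ β : SymmetricAlgebra R (M ⧸ P) →ₗ[R] N, ∀ m m',
      β (SymmetricAlgebra.ι R (M ⧸ P) (P.mkQ m) * SymmetricAlgebra.ι R (M ⧸ P) (P.mkQ m')) =
        B m m' := by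
  let B₁ : (M ⧸ P) →ₗ[R] M →ₗ[R] N := P.liftQ B fun p hp => LinearMap.ext (hP p hp)
  let B₂ : (M ⧸ P) →ₗ[R] (M ⧸ P) →ₗ[R] N := P.liftQ B₁.flip fun p hp => by
    refine LinearMap.ext fun m => ?_
    obtain ⟨m, rfl⟩ := P.mkQ_surjective m
    change B m p = 0
    rw [hB, hP p hp]
  obtain ⟨β, hβ⟩ := exists_symmetricAlgebra_linearMap B₂ fun m m' => by
    obtain ⟨m, rfl⟩ := P.mkQ_surjective m
    obtain ⟨m', rfl⟩ := P.mkQ_surjective m'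
    exact hB m' m
  exact ⟨β, fun m m' => (hβ _ _).trans (hB m' m)⟩

theorem symComponent_two : symComponent R 2 M =
    LinearMap.range (SymmetricAlgebra.ι R M) * LinearMap.range (SymmetricAlgebra.ι R M) :=
  pow_two _

/-- The map of symmetric algebras induced by a quotient map. -/
noncomputable def symmetricAlgebraMkQ (P : Submodule R M) :
    SymmetricAlgebra R M →ₐ[R] SymmetricAlgebra R (M ⧸ P) :=
  SymmetricAlgebra.lift (SymmetricAlgebra.ι R (M ⧸ P) ∘ₗ P.mkQ)

theorem symmetricAlgebraMkQ_ι (P : Submodule R M) (m : M) :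
    symmetricAlgebraMkQ P (SymmetricAlgebra.ι R M m) = SymmetricAlgebra.ι R (M ⧸ P) (P.mkQ m) := by
  simp [symmetricAlgebraMkQ]

theorem map_symmetricAlgebraMkQ_symComponent (P : Submodule R M) :
    (symComponent R 2 M).map (symmetricAlgebraMkQ P).toLinearMap = symComponent R 2 (M ⧸ P) := by
  have h : (LinearMap.range (SymmetricAlgebra.ι R M)).map (symmetricAlgebraMkQ P).toLinearMap =
      LinearMap.range (SymmetricAlgebra.ι R (M ⧸ P)) := by
    rw [← LinearMap.range_comp]
    have : (symmetricAlgebraMkQ P).toLinearMap ∘ₗ SymmetricAlgebra.ι R M =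
        SymmetricAlgebra.ι R (M ⧸ P) ∘ₗ P.mkQ := LinearMap.ext (symmetricAlgebraMkQ_ι P)
    rw [this, LinearMap.range_comp_of_range_eq_top _ P.range_mkQ]
  rw [symComponent_two, symComponent_two, Submodule.map_mul, h]

/-- The degree two part of the kernel of `Sym M → Sym (M ⧸ P)`. -/
theorem mem_of_symmetricAlgebraMkQ_eq_zero (P : Submodule R M) {s : SymmetricAlgebra R M}
    (hs : s ∈ symComponent R 2 M) (h : symmetricAlgebraMkQ P s = 0) :
    s ∈ P.map (SymmetricAlgebra.ι R M) * LinearMap.range (SymmetricAlgebra.ι R M) := by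
  set W := P.map (SymmetricAlgebra.ι R M) * LinearMap.range (SymmetricAlgebra.ι R M)
  -- Multiplication modulo W kills P, so it factors through the symmetric square of M/P; whatever
  -- dies there is zero modulo W.
  let B : M →ₗ[R] M →ₗ[R] (SymmetricAlgebra R M ⧸ W) :=
    ((LinearMap.mul R (SymmetricAlgebra R M)).compl₁₂ (SymmetricAlgebra.ι R M)
      (SymmetricAlgebra.ι R M)).compr₂ W.mkQ
  have hBdef : ∀ m m', B m m' = W.mkQ (SymmetricAlgebra.ι R M m * SymmetricAlgebra.ι R M m') :=
    fun m m' => rfl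
  obtain ⟨β, hβ⟩ := exists_symmetricAlgebra_quotient_linearMap B
    (fun m m' => by rw [hBdef, hBdef, mul_comm]) P (fun p hp m => by
      rw [hBdef, Submodule.mkQ_apply, Submodule.Quotient.mk_eq_zero]
      exact Submodule.mul_mem_mul ⟨p, hp, rfl⟩ ⟨m, rfl⟩)
  have key : ∀ s ∈ symComponent R 2 M, β (symmetricAlgebraMkQ P s) = W.mkQ s := by
    intro s hs
    rw [symComponent_two] at hs
    induction hs using Submodule.mul_induction_on' with
    | mem_mul_mem x hx y hy =>
      obtain ⟨x, rfl⟩ := hx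
      obtain ⟨y, rfl⟩ := hy
      rw [map_mul, symmetricAlgebraMkQ_ι, symmetricAlgebraMkQ_ι, hβ, hBdef]
    | add x _ y _ hx hy => rw [map_add, map_add, map_add, hx, hy]
  have := key s hs
  rw [h, map_zero, eq_comm, Submodule.mkQ_apply, Submodule.Quotient.mk_eq_zero] at this
  exact this

end SymmetricSquare

/-! ### The symmetric square of I and the product I² -/

section SymmetricSquareIdeal

variable {R : Type*} [CommRing R]

/-- The algebra map `Sym I → R` induced by the inclusion of the ideal `I`. -/
noncomputable def symmetricAlgebraEval (I : Ideal R) : SymmetricAlgebra R I →ₐ[R] R :=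
  SymmetricAlgebra.lift I.subtype

theorem symmetricAlgebraEval_ι (I : Ideal R) (x : I) :
    symmetricAlgebraEval I (SymmetricAlgebra.ι R I x) = x := by
  simp [symmetricAlgebraEval]

/-- The degree two part of the ideal of `Sym I` generated by `J`. -/
noncomputable def symmetricProducts (I J : Ideal R) : Submodule R (SymmetricAlgebra R I) :=
  (Submodule.submoduleOf J I).map (SymmetricAlgebra.ι R I) *
    LinearMap.range (SymmetricAlgebra.ι R I)

theorem symmetricProducts_le (I J : Ideal R) : symmetricProducts I J ≤ symComponent R 2 I := by
  rw [symComponent_two]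
  exact mul_le_mul' LinearMap.map_le_range le_rfl

theorem map_symmetricAlgebraEval_ι (I J : Ideal R) (h : J ≤ I) :
    ((Submodule.submoduleOf J I).map (SymmetricAlgebra.ι R I)).map
      (symmetricAlgebraEval I).toLinearMap = J := by
  rw [← Submodule.map_comp]
  have : (symmetricAlgebraEval I).toLinearMap ∘ₗ SymmetricAlgebra.ι R I = I.subtype :=
    LinearMap.ext (symmetricAlgebraEval_ι I)
  rw [this]
  exact Submodule.map_comap_eq_of_le (by simpa using h)

theorem map_symmetricAlgebraEval_symmetricProducts {I J : Ideal R} (h : J ≤ I) :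
    (symmetricProducts I J).map (symmetricAlgebraEval I).toLinearMap = J * I := by
  have h₁ := map_symmetricAlgebraEval_ι I I le_rfl
  have h₂ : Submodule.submoduleOf I I = ⊤ := Submodule.submoduleOf_self I
  rw [h₂, Submodule.map_top] at h₁
  rw [symmetricProducts, Submodule.map_mul, map_symmetricAlgebraEval_ι I J h, h₁]

theorem map_symmetricAlgebraEval_symComponent (I : Ideal R) :
    (symComponent R 2 I).map (symmetricAlgebraEval I).toLinearMap = I ^ 2 := by
  rw [pow_two, ← map_symmetricAlgebraEval_symmetricProducts le_rfl, symmetricProducts,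
    Submodule.submoduleOf_self, Submodule.map_top, symComponent_two]

/-- For `J` generated by a regular sequence, `J ⊗ I → Sym I` has image isomorphic to `J I`. -/
theorem eq_zero_of_mem_symmetricProducts {I : Ideal R} {l : List R}
    (hl : ∀ l', l'.Perm l → IsRegularSeqMod (⊥ : Ideal R) l') (hlI : Ideal.ofList l ≤ I)
    {s : SymmetricAlgebra R I} (hs : s ∈ symmetricProducts I (Ideal.ofList l))
    (h : symmetricAlgebraEval I s = 0) : s = 0 := by
  induction l generalizing s with
  | nil =>
    have : Submodule.submoduleOf (⊥ : Ideal R) I = ⊥ := by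
      ext x; simp [Submodule.submoduleOf]
    rw [symmetricProducts, Ideal.ofList_nil, this, Submodule.map_bot, Submodule.bot_mul] at hs
    exact hs
  | cons z l ih =>
    rw [Ideal.ofList_cons] at hlI
    have hzI : z ∈ I := hlI (Ideal.mem_sup_left (Ideal.mem_span_singleton_self z))
    have hlI' : Ideal.ofList l ≤ I := le_sup_right.trans hlI
    have hlast := fun l' (h : l'.Perm l) => (isRegularSeqMod_append _ _ _).1
      (hl (l' ++ [z]) ((List.perm_append_singleton z l').trans (h.cons z)))
    refine ih (fun l' h => (hlast l' h).1) hlI' ?_ h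
    have hdec : ∀ s ∈ symmetricProducts I (Ideal.ofList (z :: l)), ∃ a : I,
        ∃ s' ∈ symmetricProducts I (Ideal.ofList l),
          s = SymmetricAlgebra.ι R I ⟨z, hzI⟩ * SymmetricAlgebra.ι R I a + s' := by
      intro s hs
      rw [symmetricProducts] at hs
      induction hs using Submodule.mul_induction_on' with
      | mem_mul_mem x hx y hy =>
        obtain ⟨⟨x, hxI⟩, hx, rfl⟩ := hx
        obtain ⟨y, rfl⟩ := hy
        have hx' : x ∈ Ideal.ofList l ⊔ Ideal.span {z} := by
          rw [sup_comm, ← Ideal.ofList_cons]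
          exact hx
        obtain ⟨q, hq, t, rfl⟩ := mem_sup_span_singleton.1 hx'
        refine ⟨t • y, SymmetricAlgebra.ι R I ⟨q, hlI' hq⟩ * SymmetricAlgebra.ι R I y,
          Submodule.mul_mem_mul ⟨_, hq, rfl⟩ ⟨_, rfl⟩, ?_⟩
        have : (⟨q + t * z, hxI⟩ : I) = ⟨q, hlI' hq⟩ + t • ⟨z, hzI⟩ := rfl
        rw [this, map_add, map_smul, map_smul, add_mul, smul_mul_assoc, mul_smul_comm, add_comm]
      | add x _ y _ hx hy =>
        obtain ⟨a, s, hs, rfl⟩ := hx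
        obtain ⟨b, t, ht, rfl⟩ := hy
        refine ⟨a + b, s + t, add_mem hs ht, ?_⟩
        rw [map_add, mul_add]
        abel
    obtain ⟨a, s', hs', rfl⟩ := hdec s hs
    have hev : symmetricAlgebraEval I s' ∈ Ideal.ofList l :=
      Ideal.mul_le_left ((map_symmetricAlgebraEval_symmetricProducts hlI').le
        (Submodule.mem_map_of_mem hs'))
    -- The vanishing of z a + ev(s') puts a z in the ideal of `l`, modulo which z is regular.
    have ha : (a : R) ∈ Ideal.ofList l := by
      have hreg := (hlast l (List.Perm.refl l)).2.1
      rw [bot_sup_eq] at hreg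
      refine hreg _ ?_
      rw [map_add, map_mul, symmetricAlgebraEval_ι, symmetricAlgebraEval_ι] at h
      rw [show (a : R) * z = -symmetricAlgebraEval I s' by linear_combination h]
      exact neg_mem hev
    refine add_mem ?_ hs'
    -- Commutativity in Sym I turns z · a into a · z, with left factor now in the ideal of `l`; this
    -- absorbs the Koszul relations.
    rw [mul_comm]
    exact Submodule.mul_mem_mul ⟨a, ha, rfl⟩ ⟨_, rfl⟩

theorem symmetricAlgebraMkQ_eq_zero_of_mem {I J : Ideal R} {s : SymmetricAlgebra R I}
    (hs : s ∈ symmetricProducts I J) : symmetricAlgebraMkQ (Submodule.submoduleOf J I) s = 0 := by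
  rw [symmetricProducts] at hs
  induction hs using Submodule.mul_induction_on' with
  | mem_mul_mem x hx y hy =>
    obtain ⟨x, hx, rfl⟩ := hx
    rw [map_mul, symmetricAlgebraMkQ_ι, Submodule.mkQ_apply,
      (Submodule.Quotient.mk_eq_zero _).2 hx, map_zero, zero_mul]
  | add x _ y _ hx hy => rw [map_add, hx, hy, add_zero]

/-- The kernel of `Sym² I → I²`. -/
noncomputable def symSquareKernel (I : Ideal R) : Submodule R (SymmetricAlgebra R I) :=
  symComponent R 2 I ⊓ LinearMap.ker (symmetricAlgebraEval I).toLinearMap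

/-- The exact sequence `0 → ker (Sym² I → I²) → Sym² (I/J) → I²/JI → 0`, for `J` generated by a
regular sequence. -/
theorem length_symComponent_two {I : Ideal R} {l : List R}
    (hl : ∀ l', l'.Perm l → IsRegularSeqMod (⊥ : Ideal R) l') (hlI : Ideal.ofList l ≤ I) :
    Module.length R (symComponent R 2 (IdealQuot I (Ideal.ofList l))) =
      Module.length R (symSquareKernel I) +
        Module.length R (IdealQuot (I ^ 2) (Ideal.ofList l * I)) := by
  set J := Ideal.ofList l with hJ
  set P := Submodule.submoduleOf J I with hP
  set φ := symmetricAlgebraMkQ P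
  set ev := symmetricAlgebraEval I
  have hφ : ∀ s ∈ symComponent R 2 I, φ s ∈ symComponent R 2 (I ⧸ P) := fun s hs => by
    rw [← map_symmetricAlgebraMkQ_symComponent]
    exact ⟨s, hs, rfl⟩
  have hev : ∀ s ∈ symComponent R 2 I, ev s ∈ I ^ 2 := fun s hs => by
    rw [← map_symmetricAlgebraEval_symComponent]
    exact ⟨s, hs, rfl⟩
  let mulI : I →ₗ[R] I →ₗ[R] ↥(I ^ 2) := LinearMap.mk₂ R
    (fun x y => ⟨x * y, by rw [pow_two]; exact Ideal.mul_mem_mul x.2 y.2⟩)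
    (fun x y z => Subtype.ext (add_mul _ _ _)) (fun r x y => Subtype.ext (mul_assoc _ _ _))
    (fun x y z => Subtype.ext (mul_add _ _ _)) (fun r x y => Subtype.ext (mul_left_comm _ _ _))
  let B : I →ₗ[R] I →ₗ[R] IdealQuot (I ^ 2) (J * I) := mulI.compr₂ (Submodule.mkQ _)
  have hBdef : ∀ x y, B x y = Submodule.Quotient.mk (mulI x y) := fun _ _ => rfl
  have hmulI : ∀ x y, ((mulI x y : ↥(I ^ 2)) : R) = x * y := fun _ _ => rfl
  obtain ⟨β, hβ⟩ := exists_symmetricAlgebra_quotient_linearMap B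
    (fun x y => by
      rw [hBdef, hBdef]; congr 1; exact Subtype.ext (by rw [hmulI, hmulI, mul_comm])) P
    (fun p hp y => by
      rw [hBdef, Submodule.Quotient.mk_eq_zero]
      exact Ideal.mul_mem_mul (I := J) hp y.2)
  have hβφ : ∀ s (hs : s ∈ symComponent R 2 I),
      β (φ s) = Submodule.Quotient.mk ⟨ev s, hev s hs⟩ := by
    intro s hs
    have hs' := hs
    rw [symComponent_two] at hs'
    induction hs' using Submodule.mul_induction_on' with
    | mem_mul_mem x hx y hy =>
      obtain ⟨x, rfl⟩ := hx
      obtain ⟨y, rfl⟩ := hy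
      simp only [φ, map_mul, symmetricAlgebraMkQ_ι]
      rw [hβ, hBdef]
      congr 1
      refine Subtype.ext ?_
      simp only [ev, hmulI, symmetricAlgebraEval_ι]
    | add x hx y hy hx' hy' =>
      rw [← symComponent_two] at hx hy
      rw [map_add, map_add, hx' hx, hy' hy, ← Submodule.Quotient.mk_add]
      congr 1
      exact Subtype.ext (map_add _ _ _).symm
  let f : symSquareKernel I →ₗ[R] symComponent R 2 (I ⧸ P) :=
    φ.toLinearMap.restrict fun s hs => hφ s hs.1
  let g : symComponent R 2 (I ⧸ P) →ₗ[R] IdealQuot (I ^ 2) (J * I) :=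
    β.domRestrict (symComponent R 2 (I ⧸ P))
  have hf : ∀ s, (f s : SymmetricAlgebra R (I ⧸ P)) = φ s := fun _ => rfl
  have hg : ∀ s, g s = β s := fun _ => rfl
  refine Module.length_eq_add_of_exact f g ?_ ?_ ?_
  · rw [← LinearMap.ker_eq_bot, LinearMap.ker_eq_bot']
    rintro ⟨s, hs⟩ h0
    have h0' : φ s = 0 := by rw [← hf ⟨s, hs⟩, h0]; rfl
    exact Subtype.ext (eq_zero_of_mem_symmetricProducts hl hlI
      (mem_of_symmetricAlgebraMkQ_eq_zero P hs.1 h0') hs.2)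
  · intro q
    obtain ⟨⟨w, hw⟩, rfl⟩ := Submodule.Quotient.mk_surjective _ q
    have hw' := hw
    rw [← map_symmetricAlgebraEval_symComponent] at hw'
    obtain ⟨s, hs, rfl⟩ := hw'
    exact ⟨⟨φ s, hφ s hs⟩, by rw [hg]; exact hβφ s hs⟩
  · rintro ⟨y, hy⟩
    have hy' := hy
    rw [← map_symmetricAlgebraMkQ_symComponent] at hy'
    obtain ⟨s, hs, rfl⟩ := hy'
    constructor
    · intro h0
      rw [hg] at h0
      have h1 := (hβφ s hs).symm.trans h0
      rw [Submodule.Quotient.mk_eq_zero] at h1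
      have h2 : ev s ∈ J * I := h1
      rw [← map_symmetricAlgebraEval_symmetricProducts hlI] at h2
      obtain ⟨w, hw, hws⟩ := h2
      -- Since w has the same value as s and dies in Sym(I/J), s − w is a lift of the same class
      -- lying in the kernel of evaluation.
      refine ⟨⟨s - w, sub_mem hs (symmetricProducts_le I J hw), ?_⟩, Subtype.ext ?_⟩
      · change ev (s - w) = 0
        rw [map_sub, sub_eq_zero]
        exact hws.symm
      · rw [hf]
        change φ (s - w) = φ s
        rw [map_sub, show φ w = 0 from symmetricAlgebraMkQ_eq_zero_of_mem hw, sub_zero]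
    · rintro ⟨⟨t, ht⟩, hts⟩
      rw [← hts, hg, hf]
      refine (hβφ t ht.1).trans ?_
      rw [Submodule.Quotient.mk_eq_zero]
      have h3 : ev t = 0 := ht.2
      change ev t ∈ J * I
      rw [h3]
      exact zero_mem _

end SymmetricSquareIdeal

/-! ### Minimal reductions in a Cohen–Macaulay ring -/

section Main

variable {R : Type*} [CommRing R]

theorem isRegularSeqMod_of_forall {A : Ideal R} {l : List R}
    (h : ∀ i (hi : i < l.length), IsRegularMod (A ⊔ Ideal.ofList (l.take i)) l[i]) :
    IsRegularSeqMod A l := by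
  induction l generalizing A with
  | nil => trivial
  | cons z l ih =>
    have h0 := h 0 (by simp)
    rw [List.take_zero, Ideal.ofList_nil, sup_bot_eq] at h0
    refine ⟨h0, ih fun i hi => ?_⟩
    have := h (i + 1) (by simpa using hi)
    rwa [List.take_succ_cons, Ideal.ofList_cons, ← sup_assoc, List.getElem_cons_succ] at this

theorem IsRegular.isRegularSeqMod {l : List R} (h : IsRegular R l) :
    IsRegularSeqMod (⊥ : Ideal R) l := by
  refine isRegularSeqMod_of_forall fun i hi u hu => ?_
  have := h.regular_mod_prev i hi
  rw [bot_sup_eq] at hu ⊢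
  have h0 : (Ideal.ofList (l.take i) • ⊤ : Submodule R R) = Ideal.ofList (l.take i) := by simp
  rw [h0] at this
  rw [← Submodule.Quotient.mk_eq_zero]
  refine this ?_
  change l[i] • Submodule.Quotient.mk u = l[i] • 0
  rw [smul_zero, ← Submodule.Quotient.mk_smul, Submodule.Quotient.mk_eq_zero, smul_eq_mul, mul_comm]
  exact hu

theorem ofList_perm {l l' : List R} (h : l'.Perm l) : Ideal.ofList l' = Ideal.ofList l := by
  unfold Ideal.ofList
  congr 1
  ext r
  exact h.mem_iff

theorem ofList_le_iff {l : List R} {I : Ideal R} : Ideal.ofList l ≤ I ↔ ∀ r ∈ l, r ∈ I := by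
  rw [Ideal.ofList, Ideal.span_le]
  rfl

theorem idealQuot_smul_eq_zero {I J : Ideal R} {r : R} (hr : r ∈ J) (x : IdealQuot I J) :
    r • x = 0 := by
  obtain ⟨x, rfl⟩ := Submodule.Quotient.mk_surjective _ x
  rw [← Submodule.Quotient.mk_smul, Submodule.Quotient.mk_eq_zero]
  exact J.mul_mem_right (x : R) hr

variable [IsLocalRing R]

/-- The depth is finite, so its supremum is attained by a regular sequence of length dim R. The
quotient by it has dimension 0, hence every prime above it is m. -/
theorem IsCohenMacaulayLocal.exists_regular_parameters (hCM : IsCohenMacaulayLocal R) :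
    ∃ l : List R, IsRegularSeqMod (⊥ : Ideal R) l ∧ (∀ r ∈ l, r ∈ maximalIdeal R) ∧
      maximalIdeal R ≤ (Ideal.ofList l).radical := by
  have := hCM.noetherian
  have hdep := hCM.depth_eq_dim
  set S := {k : ℕ∞ | ∃ rs : List R, IsRegular R rs ∧
    (∀ r ∈ rs, r ∈ maximalIdeal R) ∧ k = (rs.length : ℕ∞)} with hS
  have hlt : sSup S < ⊤ := by
    have h1 : (localDepth R : WithBot ℕ∞) < ⊤ := hdep ▸ ringKrullDim_lt_top
    exact WithBot.coe_lt_coe.1 h1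
  have : Nonempty S := ⟨⟨0, [], IsRegular.nil R R, by simp, by simp⟩⟩
  obtain ⟨l, hreg, hlm, hlen⟩ := ENat.sSup_mem_of_nonempty_of_lt_top hlt
  refine ⟨l, IsRegular.isRegularSeqMod hreg, hlm, ?_⟩
  have hdim : ringKrullDim (R ⧸ Ideal.ofList l) = 0 := by
    have h1 := ringKrullDim_add_length_eq_ringKrullDim_of_isRegular l hreg
    have h2 : ((l.length : ℕ∞) : WithBot ℕ∞) = ringKrullDim R := by
      rw [← hdep, ← hlen]; rfl
    rw [← h2] at h1
    generalize ringKrullDim (R ⧸ Ideal.ofList l) = x at h1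
    cases x with
    | bot => exact absurd h1 (by rw [WithBot.bot_add]; exact WithBot.bot_ne_coe)
    | coe x =>
      have h3 : x + (l.length : ℕ∞) = 0 + (l.length : ℕ∞) := by rw [zero_add]; exact_mod_cast h1
      rw [ENat.add_left_injective_of_ne_top (ENat.natCast_ne_top l.length) h3]
      rfl
  rw [Ideal.radical_eq_sInf]
  refine le_sInf ?_
  rintro P ⟨hle, hP⟩
  have h0 : Ring.KrullDimLE 0 (R ⧸ Ideal.ofList l) := Ring.krullDimLE_iff.2 (by simp [hdim])
  have hmax := Ring.krullDimLE_zero_iff.1 h0 (P.map (Ideal.Quotient.mk (Ideal.ofList l)))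
    (Ideal.isPrime_map_quotientMk_of_isPrime hle)
  have hcomap := Ideal.comap_isMaximal_of_surjective (Ideal.Quotient.mk (Ideal.ofList l))
    Ideal.Quotient.mk_surjective (K := P.map (Ideal.Quotient.mk (Ideal.ofList l)))
  rw [Ideal.comap_map_of_surjective _ Ideal.Quotient.mk_surjective, ← RingHom.ker_eq_comap_bot,
    Ideal.mk_ker, sup_eq_left.2 hle] at hcomap
  exact (eq_maximalIdeal hcomap).ge

variable [IsNoetherianRing R]

theorem IsMinimalReductionOf.exists_ofList [Infinite (ResidueField R)] {l : List R}
    (hl : IsRegularSeqMod (⊥ : Ideal R) l) (hlm : ∀ r ∈ l, r ∈ maximalIdeal R)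
    (hlr : maximalIdeal R ≤ (Ideal.ofList l).radical) {I J : Ideal R}
    (hI : I.radical = maximalIdeal R) (hJ : IsMinimalReductionOf J I) :
    ∃ y : List R, y.length = l.length ∧ Ideal.ofList y = J ∧
      ∀ y', y'.Perm y → IsRegularSeqMod (⊥ : Ideal R) y' := by
  have perm : ∀ y : List R, y.length = l.length → Ideal.ofList y ≤ maximalIdeal R →
      maximalIdeal R ≤ (Ideal.ofList y).radical →
      ∀ y', y'.Perm y → IsRegularSeqMod (⊥ : Ideal R) y' := by
    intro y hlen hym hyr y' h
    rw [← ofList_perm h] at hym hyr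
    exact isRegularSeqMod_of_maximalIdeal_le_radical hl hlm (h.length_eq.trans hlen)
      (ofList_le_iff.1 hym) (by rwa [bot_sup_eq])
  have hIm : I ≤ maximalIdeal R := hI ▸ Ideal.le_radical
  have hJm : J ≤ maximalIdeal R := hJ.prop.1.trans hIm
  have hJr : maximalIdeal R ≤ J.radical := hI ▸ hJ.prop.radical_le
  obtain ⟨s, hs, a, ha⟩ := exists_reduction_fin (perm l rfl (ofList_le_iff.2 hlm) hlr) hlm hlr
    hJm hJr
  have hJa : Ideal.span (Set.range a) = J :=
    le_antisymm ha.1 (hJ.le_of_le (ha.trans hJ.prop) ha.1)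
  -- Padding with zeros gives length d without knowing s = d, an equality that the regularity of the
  -- list then forces.
  have hy : Ideal.ofList (List.ofFn a ++ List.replicate (l.length - s) 0) = J := by
    rw [← hJa, Ideal.ofList_append]
    have h0 : Ideal.ofList (List.replicate (l.length - s) (0 : R)) = ⊥ :=
      le_bot_iff.1 (ofList_le_iff.2 fun r hr => List.eq_of_mem_replicate hr)
    rw [h0, sup_bot_eq, Ideal.ofList]
    congr 1
    ext r
    exact List.mem_ofFn' a r
  have hlen : (List.ofFn a ++ List.replicate (l.length - s) 0).length = l.length := by
    simp; omega
  exact ⟨_, hlen, hy, perm _ hlen (hy ▸ hJm) (hy ▸ hJr)⟩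

/-- Such an M is a quotient of a finite power of R/J. -/
theorem length_ne_top_of_smul_eq_zero {J : Ideal R} (hJ : maximalIdeal R ≤ J.radical)
    {M : Type*} [AddCommGroup M] [Module R M] [Module.Finite R M]
    (hM : ∀ r ∈ J, ∀ x : M, r • x = 0) : Module.length R M ≠ ⊤ := by
  obtain ⟨n, f, hf⟩ := Module.Finite.exists_fin' R M
  let p : Submodule R (Fin n → R) := Submodule.pi Set.univ fun _ => J
  have hp : p ≤ LinearMap.ker f := by
    intro v hv
    have hv' : ∀ i, v i ∈ J := fun i => hv i trivial
    rw [LinearMap.mem_ker, pi_eq_sum_univ' v, map_sum]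
    exact Finset.sum_eq_zero fun i _ => by rw [map_smul, hM _ (hv' i)]
  have h₁ : Function.Surjective (p.liftQ f hp) := fun x =>
    (hf x).imp' (Submodule.Quotient.mk) fun v hv => hv
  have h₂ := Module.length_le_of_surjective _ h₁
  rw [(Submodule.quotientPi fun _ : Fin n => J).length_eq, Module.length_pi_of_fintype] at h₂
  refine ne_top_of_le_ne_top ?_ h₂
  rw [Finset.sum_const, nsmul_eq_mul]
  exact WithTop.mul_ne_top (ENat.natCast_ne_top _) (length_quotient_ne_top hJ)

theorem length_symComponent_ne_top {J : Ideal R} (hJ : maximalIdeal R ≤ J.radical)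
    {M : Type*} [AddCommGroup M] [Module R M] [Module.Finite R M]
    (hM : ∀ r ∈ J, ∀ x : M, r • x = 0) : Module.length R (symComponent R 2 M) ≠ ⊤ := by
  have hfg : (LinearMap.range (SymmetricAlgebra.ι R M)).FG := by
    rw [← Submodule.map_top]
    exact Module.Finite.fg_top.map _
  have : Module.Finite R (symComponent R 2 M) := by
    rw [Module.Finite.iff_fg, symComponent_two]
    exact hfg.mul hfg
  refine length_ne_top_of_smul_eq_zero hJ fun r hr => ?_
  rintro ⟨s, hs⟩
  refine Subtype.ext (show r • s = 0 from ?_)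
  rw [symComponent_two] at hs
  induction hs using Submodule.mul_induction_on' with
  | mem_mul_mem x hx y hy =>
    obtain ⟨x, rfl⟩ := hx
    rw [← smul_mul_assoc, ← map_smul, hM r hr, map_zero, zero_mul]
  | add x _ y _ hx hy => rw [smul_add, hx, hy, add_zero]

/-- The colength of a reduction generated by a regular sequence is the multiplicity. -/
theorem length_quotient_ofList_le {I : Ideal R} {y₁ y₂ : List R}
    (h₁ : ∀ y', y'.Perm y₁ → IsRegularSeqMod (⊥ : Ideal R) y')
    (h₂ : ∀ y', y'.Perm y₂ → IsRegularSeqMod (⊥ : Ideal R) y')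
    (hlen : y₁.length = y₂.length) (hy₁ : IsReductionOf (Ideal.ofList y₁) I)
    (hy₂ : IsReductionOf (Ideal.ofList y₂) I) (hI : maximalIdeal R ≤ I.radical) :
    Module.length R (R ⧸ Ideal.ofList y₁) ≤ Module.length R (R ⧸ Ideal.ofList y₂) := by
  obtain ⟨e₁, he₁⟩ := ENat.ne_top_iff_exists.1
    (length_quotient_ne_top (hI.trans hy₁.radical_le))
  obtain ⟨e₂, he₂⟩ := ENat.ne_top_iff_exists.1
    (length_quotient_ne_top (hI.trans hy₂.radical_le))
  rw [← he₁, ← he₂]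
  obtain ⟨-, r, hr⟩ := hy₁
  refine Nat.cast_le.2 (le_of_forall_mul_multichoose_le (k := y₁.length) (r := r) fun n => ?_)
  -- The exponent r of the first reduction bounds the shift, which is lost when leading coefficients
  -- are compared.
  have hle : Ideal.ofList y₂ ^ (n + r + 1) ≤ Ideal.ofList y₁ ^ (n + 1) := calc
    Ideal.ofList y₂ ^ (n + r + 1) ≤ I ^ (n + r + 1) := Ideal.pow_right_mono hy₂.1 _
    _ = Ideal.ofList y₁ ^ (n + 1) * I ^ r := by
        rw [← IsReductionOf.pow_eq hr (n + 1)]; congr 1; ring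
    _ ≤ Ideal.ofList y₁ ^ (n + 1) := Ideal.mul_le_left
  have hL := length_quotient_le_of_le hle
  have e₁' := length_quotient_sup_pow h₁ n
  have e₂' := length_quotient_sup_pow h₂ (n + r)
  rw [bot_sup_eq, bot_sup_eq] at e₁' e₂'
  rw [e₁', e₂', ← he₁, ← he₂, ← hlen] at hL
  rw [mul_comm e₁, mul_comm e₂]
  exact_mod_cast hL

end Main

theorem proposition2p1 {R : Type*} [CommRing R] [IsLocalRing R]
    (hCM : IsCohenMacaulayLocal R) (hdim : 0 < ringKrullDim R)
    (hinf : Infinite (IsLocalRing.ResidueField R))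
    (I : Ideal R) (hI : I.IsPrimary) (hIm : I.radical = IsLocalRing.maximalIdeal R)
    (J₁ J₂ : Ideal R) (hJ₁ : IsMinimalReductionOf J₁ I) (hJ₂ : IsMinimalReductionOf J₂ I) :
    (Module.length R (IdealQuot I J₁) ≠ ⊤ ∧
      Module.length R (IdealQuot I J₁) = Module.length R (IdealQuot I J₂)) ∧
    (∀ n : ℕ, 2 ≤ n →
      Module.length R (IdealQuot (I ^ n) (J₁ ^ (n - 1) * I)) ≠ ⊤ ∧
      Module.length R (IdealQuot (I ^ n) (J₁ ^ (n - 1) * I)) =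
        Module.length R (IdealQuot (I ^ n) (J₂ ^ (n - 1) * I))) ∧
    (Module.length R (R ⧸ Submodule.colon J₁ (I : Set R)) ≠ ⊤ ∧
      Module.length R (R ⧸ Submodule.colon J₁ (I : Set R)) =
        Module.length R (R ⧸ Submodule.colon J₂ (I : Set R))) ∧
    (Module.length R (symComponent R 2 (IdealQuot I J₁)) ≠ ⊤ ∧
      Module.length R (symComponent R 2 (IdealQuot I J₁)) =
        Module.length R (symComponent R 2 (IdealQuot I J₂))) := by
  have := hCM.noetherian
  obtain ⟨l, hl, hlm, hlr⟩ := hCM.exists_regular_parameters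
  have hIr : maximalIdeal R ≤ I.radical := hIm.ge
  have hIle : I ≤ maximalIdeal R := hIm ▸ Ideal.le_radical
  obtain ⟨y₁, hlen₁, rfl, hreg₁⟩ := hJ₁.exists_ofList hl hlm hlr hIm
  obtain ⟨y₂, hlen₂, rfl, hreg₂⟩ := hJ₂.exists_ofList hl hlm hlr hIm
  have hlen := hlen₁.trans hlen₂.symm
  have hr₁ := hJ₁.prop
  have hr₂ := hJ₂.prop
  have hJr₁ := hIr.trans hr₁.radical_le
  have hJr₂ := hIr.trans hr₂.radical_le
  have he : Module.length R (R ⧸ Ideal.ofList y₁) = Module.length R (R ⧸ Ideal.ofList y₂) :=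
    le_antisymm (length_quotient_ofList_le hreg₁ hreg₂ hlen hr₁ hr₂ hIr)
      (length_quotient_ofList_le hreg₂ hreg₁ hlen.symm hr₂ hr₁ hIr)
  have hfin : ∀ {A B : Ideal R}, A ≤ B → maximalIdeal R ≤ A.radical →
      Module.length R (IdealQuot B A) ≠ ⊤ := fun hAB hA htop => length_quotient_ne_top hA (by
    rw [length_quotient_eq_add_idealQuot hAB, htop, top_add])
  have hrad : ∀ {J : Ideal R}, maximalIdeal R ≤ J.radical → ∀ n,
      maximalIdeal R ≤ (J ^ n * I).radical := by
    intro J hJ n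
    rw [Ideal.radical_mul]
    refine le_inf (hJ.trans ?_) hIr
    rcases n with _ | n
    · rw [pow_zero, Ideal.one_eq_top, Ideal.radical_top]; exact le_top
    · rw [Ideal.radical_pow _ n.succ_ne_zero]
  have hle : ∀ {J : Ideal R}, J ≤ I → ∀ n, J ^ n * I ≤ I ^ (n + 1) := fun hJ n => by
    rw [pow_succ]
    exact Ideal.mul_mono_left (Ideal.pow_right_mono hJ n)
  have hpow : ∀ n : ℕ,
      Module.length R (IdealQuot (I ^ (n + 1 + 1)) (Ideal.ofList y₁ ^ (n + 1) * I)) =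
      Module.length R (IdealQuot (I ^ (n + 1 + 1)) (Ideal.ofList y₂ ^ (n + 1) * I)) := by
    intro n
    have e₁ := length_quotient_sup_pow_mul hreg₁ (I := I) (by rw [bot_sup_eq]; exact hr₁.1) n
    have e₂ := length_quotient_sup_pow_mul hreg₂ (I := I) (by rw [bot_sup_eq]; exact hr₂.1) n
    rw [bot_sup_eq, bot_sup_eq, length_quotient_eq_add_idealQuot (hle hr₁.1 _)] at e₁
    rw [bot_sup_eq, bot_sup_eq, length_quotient_eq_add_idealQuot (hle hr₂.1 _), ← he, ← hlen,
      ← e₁] at e₂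
    have hI' : Module.length R (R ⧸ I ^ (n + 1 + 1)) ≠ ⊤ :=
      length_quotient_ne_top (by rwa [Ideal.radical_pow _ (n + 1).succ_ne_zero])
    exact (ENat.add_left_injective_of_ne_top hI' e₂).symm
  refine ⟨⟨hfin hr₁.1 hJr₁, ?_⟩, fun n hn => ?_, ⟨?_, ?_⟩, ?_, ?_⟩
  · rw [length_quotient_eq_add_idealQuot hr₁.1, length_quotient_eq_add_idealQuot hr₂.1] at he
    exact ENat.add_left_injective_of_ne_top (length_quotient_ne_top hIr) he
  · obtain ⟨n, rfl⟩ := Nat.exists_eq_add_of_le' hn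
    exact ⟨hfin (hle hr₁.1 _) (hrad hJr₁ _), hpow n⟩
  · exact length_quotient_ne_top (hJr₁.trans (Ideal.radical_mono Ideal.le_colon))
  -- λ(R/J) = λ((J : I)/J) + λ(R/(J : I)), where the first summand is finite and common to both
  -- reductions.
  · have hc := length_colon_sup_ofList_eq hIle (hreg₁ _ (List.Perm.refl _))
      (ofList_le_iff.1 hr₁.1) (hreg₂ _ (List.Perm.refl _)) (ofList_le_iff.1 hr₂.1) hlen.symm
    rw [bot_sup_eq, bot_sup_eq] at hc
    rw [length_quotient_eq_add_idealQuot (A := Ideal.ofList y₁) (Ideal.le_colon (S := (I : Set R))),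
      length_quotient_eq_add_idealQuot (A := Ideal.ofList y₂) (Ideal.le_colon (S := (I : Set R))),
      hc] at he
    exact ENat.add_right_injective_of_ne_top (hc ▸ hfin Ideal.le_colon hJr₁) he
  · exact length_symComponent_ne_top hJr₁ fun r hr x => idealQuot_smul_eq_zero hr x
  · rw [length_symComponent_two hreg₁ hr₁.1, length_symComponent_two hreg₂ hr₂.1]
    congr 1
    have := hpow 0
    rwa [zero_add, pow_one, pow_one] at this
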